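/- Let $\mathbb{D}$ be the open unit disc, $\mathbb{T}$ its boundary, and $dA=\frac{dx\,dy}{\pi}$. Let $\omega:[0,1)\to(0,\infty)$ be a continuous function such that $\omega(z)=\omega(|z|)$ is integrable over $\mathbb{D}$ (a continuous radial weight), put $$\psi_\omega(r)=\frac1{\omega(r)}\int_r^1\omega(s)\,ds,\qquad 0\le r<1,$$ and assume that $\omega$ is rapidly increasing, that is, $\lim_{r\to1^-}\frac{\psi_\omega(r)}{1-r}=\infty$. A function $h:[0,1)\to(0,\infty)$ is called essentially increasing if there is a constant $C>0$ such that $h(r)\le C\,h(t)$ for all $0\le r\le t<1$. Assume that both $\omega(r)$ and $\frac{\psi_\omega(r)}{1-r}$ are essentially increasing on $[0,1)$, and that there is a constant $C>0$ such that $$\int_r^1\omega(s)s\,ds\le C\int_{\frac{2r}{1+r^2}}^1\omega(s)s\,ds,\qquad 0\le r<1.$$ Let $\omega^\star(z)=\int_{|z|}^1\omega(s)\log\frac{s}{|z|}\,s\,ds$ for $z\in\mathbb{D}\setminus\{0\}$. For an arc $I\subset\mathbb{T}$ of length $|I|>0$ let $S(I)=\{re^{it}\in\mathbb{D}:e^{it}\in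 I,\ 1-|I|\le r<1\}$ and $\omega(S(I))=\int_{S(I)}\omega\,dA$. For $g$ analytic in $\mathbb{D}$ define $$\rho(g)^2=\sup_{I\subset\mathbb{T}}\frac{\int_{S(I)}|g'(z)|^2\omega^\star(z)\,dA(z)}{\omega(S(I))},\qquad \|g\|_{\mathcal{C}^1(\omega^\star)}^2=|g(0)|^2+\rho(g)^2,$$ and let $\mathcal{C}^1(\omega^\star)$ be the space of all $g$ analytic in $\mathbb{D}$ with $\|g\|_{\mathcal{C}^1(\omega^\star)}<\infty$. Then $\mathcal{C}^1(\omega^\star)$ is not conformally invariant: there is no constant $C>0$ such that $$\sup_{\varphi}\rho(g\circ\varphi)\le C\,\rho(g)\qquad\text{for all } g\in\mathcal{C}^1(\omega^\star),$$ where the supremum is taken over all Möbius transformations $\varphi$ of $\mathbb{D}$ onto itself (values $+\infty$ being allowed on the left). The same holds with the norm $\|\cdot\|_{\mathcal{C}^1(\omega^\star)}$ in place of the seminorm $\rho$. -/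

import Mathlib

open MeasureTheory Set Filter Topology
open scoped Real ENNReal NNReal

noncomputable section

namespace BergmanWeights

/-- The open unit disc of the complex plane. -/
def unitDisc : Set ℂ := Metric.ball (0 : ℂ) 1

/-- The normalized area measure `dA = dx dy / π`. -/
def areaMeasure : Measure ℂ := ENNReal.ofReal (1 / π) • (volume : Measure ℂ)

/-- `ω : [0,1) → (0,∞)` is (the profile of) a radial weight: it is positive and `z ↦ ω(|z|)` is
integrable over the unit disc. -/
structure IsRadialWeight (ω : ℝ → ℝ) : Prop where
  pos : ∀ r ∈ Ico (0 : ℝ) 1, 0 < ω r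
  integrable : IntegrableOn (fun z : ℂ => ω ‖z‖) unitDisc areaMeasure

/-- The distortion function `ψ_ω(r) = (1 / ω(r)) ∫_r^1 ω(s) ds`. -/
def distortion (ω : ℝ → ℝ) (r : ℝ) : ℝ := (1 / ω r) * ∫ s in r..1, ω s

/-- Rapidly increasing weights: continuous radial weights with `ψ_ω(r) / (1 - r) → ∞` as
`r → 1⁻`. -/
structure IsRapidlyIncreasing (ω : ℝ → ℝ) : Prop extends IsRadialWeight ω where
  continuousOn : ContinuousOn ω (Ico (0 : ℝ) 1)
  tendsto_distortion : Tendsto (fun r => distortion ω r / (1 - r)) (𝓝[<] (1 : ℝ)) atTop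

/-- `h` is essentially increasing on `[0,1)`: `h(r) ≤ C h(t)` for all `0 ≤ r ≤ t < 1`. -/
def EssentiallyIncreasing (h : ℝ → ℝ) : Prop :=
  ∃ C : ℝ, 0 < C ∧ ∀ r t : ℝ, 0 ≤ r → r ≤ t → t < 1 → h r ≤ C * h t

/-- The associated weight `ω^⋆(z) = ∫_{|z|}^1 ω(s) log(s/|z|) s ds`, for `z ≠ 0`. (The value at the
single point `z = 0` plays no role below.) -/
def associatedWeight (ω : ℝ → ℝ) (z : ℂ) : ℝ :=
  ∫ s in ‖z‖..1, ω s * Real.log (s / ‖z‖) * s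

/-- The Carleson square `S(I) = {r e^{it} ∈ 𝔻 : e^{it} ∈ I, 1 - |I| ≤ r < 1}` of the arc
`I = {e^{it} : c ≤ t ≤ c + ℓ}` of length `|I| = ℓ`. -/
def carlesonSquare (c ℓ : ℝ) : Set ℂ :=
  {z | ∃ r t : ℝ, 0 ≤ r ∧ 1 - ℓ ≤ r ∧ r < 1 ∧ t ∈ Icc c (c + ℓ) ∧
    z = (r : ℂ) * Complex.exp (t * Complex.I)}

/-- `ω(E) = ∫_E ω(z) dA(z)`. -/
def weightMass (ω : ℝ → ℝ) (E : Set ℂ) : ℝ≥0∞ :=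
  ∫⁻ z in E, ENNReal.ofReal (ω ‖z‖) ∂areaMeasure

/-- `sup_I (∫_{S(I)} |g'(z)|² ω^⋆(z) dA(z)) / ω(S(I))`, the supremum being taken over all
nondegenerate arcs `I` of the unit circle. -/
def carlesonSup (ω : ℝ → ℝ) (g : ℂ → ℂ) : ℝ≥0∞ :=
  ⨆ (c : ℝ) (ℓ : ℝ) (_ : 0 < ℓ ∧ ℓ ≤ 2 * π),
    (∫⁻ z in carlesonSquare c ℓ, ENNReal.ofReal (‖deriv g z‖ ^ 2 * associatedWeight ω z)
      ∂areaMeasure) / weightMass ω (carlesonSquare c ℓ)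

/-- The norm of `𝒞¹(ω^⋆)`: `‖g‖² = |g(0)|² + sup_I ...`, as an extended number. -/
def C1Norm (ω : ℝ → ℝ) (g : ℂ → ℂ) : ℝ≥0∞ :=
  (‖g 0‖ₑ ^ 2 + carlesonSup ω g) ^ (1 / 2 : ℝ)

/-- The seminorm of `𝒞¹(ω^⋆)` that vanishes on constants, as an extended number. -/
def C1Seminorm (ω : ℝ → ℝ) (g : ℂ → ℂ) : ℝ≥0∞ := (carlesonSup ω g) ^ (1 / 2 : ℝ)

/-- The space `𝒞¹(ω^⋆)` of analytic functions in the unit disc with finite norm. -/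
def C1Space (ω : ℝ → ℝ) : Set (ℂ → ℂ) :=
  {g | DifferentiableOn ℂ g unitDisc ∧ C1Norm ω g < ∞}

/-- Möbius transformations `z ↦ (a z + b) / (c z + d)` of the unit disc onto itself. -/
def IsDiscMobius (φ : ℂ → ℂ) : Prop :=
  (∃ a b c d : ℂ, a * d - b * c ≠ 0 ∧
    ∀ z ∈ unitDisc, c * z + d ≠ 0 ∧ φ z = (a * z + b) / (c * z + d)) ∧
  φ '' unitDisc = unitDisc

/-- A space `X` of functions on the disc with a seminorm `ρ` (extended by `∞` outside `X`) is
conformally invariant if `sup_φ ρ(g ∘ φ) ≤ C ρ(g)` for all `g ∈ X`, the supremum being over all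
Möbius transformations `φ` of the disc onto itself. -/
def IsConformallyInvariant (X : Set (ℂ → ℂ)) (ρ : (ℂ → ℂ) → ℝ≥0∞) : Prop :=
  ∃ C : ℝ≥0, 0 < C ∧ ∀ g ∈ X, (⨆ (φ : ℂ → ℂ) (_ : IsDiscMobius φ), ρ (g ∘ φ)) ≤ C * ρ g

end BergmanWeights

end

/-! The test functions are lacunary polynomials `g = ∑ b_k z^(2^k)`, whose seminorms stay bounded
while suitable Möbius compositions see `∑ b_k²`, which can be made arbitrarily large.

Write `G_k` for the moment `∫_0^1 ω(s) s^(2^k+1) ds`. On a Carleson square of side `ℓ ~ 2^(-m)`, the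
frequencies below `2^m` are bounded trivially by `|g'| ≤ 2^m`; those from `2^m` on are orthogonal on
an arc of length `2π/2^m` and contribute about `ℓ ∑_{k ≥ m} b_k² G_k`. Essential monotonicity of `ω`
gives `G_m ≲ ∫_{1-ℓ}^1 ω(s) s ds`, so the seminorm is controlled once `|b_k| ≤ 1` and `∑_{k ≥ m}
b_k² G_k ≤ G_m` (`exists_carlesonSup_lacunary_le`). Taking `b_k² = (G_k - G_{k+1})/G_k` makes this
sum telescope, while `∑ b_k² = ∞` because `G_k → 0` (`exists_lacunary_coefficients`).

In the other direction, the doubling condition compares the tail of `ω` at distance `ε` from the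
circle with its tail at distance `ε²`. An automorphism carrying the half disc `{Re w > 0, |w| < 1 -
δ}` into a square of side `16ε` at the point 1, with `ε` small against `δ`, therefore pulls `ω^⋆`
back to at least a constant times `ε (1 - |w|)` times one fixed tail. The quotient for that square
dominates `∫ |g'(w)|² (1 - |w|)` over the half disc, a Hardy-type integral bounded below by a
multiple of `∑ b_k²` (`exists_le_carlesonSup_lacunary_comp`). -/

namespace BergmanWeights

/-! ### Polar coordinates and integration over Carleson squares. -/

/-- The point with polar coordinates `(r, θ)`. -/
noncomputable def polarPt (r θ : ℝ) : ℂ := (r : ℂ) * Complex.exp (θ * Complex.I)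

@[fun_prop]
lemma continuous_polarPt : Continuous (fun p : ℝ × ℝ => polarPt p.1 p.2) := by
  unfold polarPt; fun_prop

@[fun_prop]
lemma continuous_polarPt_right (r : ℝ) : Continuous (polarPt r) := by
  unfold polarPt; fun_prop

@[simp]
lemma norm_polarPt (r θ : ℝ) : ‖polarPt r θ‖ = |r| := by
  simp [polarPt, Complex.norm_exp_ofReal_mul_I]

lemma polarPt_add_two_pi (r θ : ℝ) : polarPt r (θ + 2 * π) = polarPt r θ := by
  unfold polarPt
  have : ((θ + 2 * π : ℝ) : ℂ) * Complex.I = θ * Complex.I + 2 * π * Complex.I := by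
    push_cast; ring
  rw [this, Complex.exp_periodic]

lemma setLIntegral_Ioc_periodic {T : ℝ} (hT : 0 < T) (f : ℝ → ℝ≥0∞) (hf : Function.Periodic f T)
    (c d : ℝ) : ∫⁻ x in Ioc c (c + T), f x = ∫⁻ x in Ioc d (d + T), f x := by
  refine (isAddFundamentalDomain_Ioc hT c).setLIntegral_eq (isAddFundamentalDomain_Ioc hT d) f ?_
  rintro ⟨g, hg⟩ x
  obtain ⟨n, rfl⟩ := AddSubgroup.mem_zmultiples_iff.1 hg
  have := hf.zsmul n x
  simpa [AddSubgroup.vadd_def, add_comm] using this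

/-- The angular window may start at any `c`, so that an arc starting at `c` is a single interval and
never wraps around. -/
lemma lintegral_polar (f : ℂ → ℝ≥0∞) (hf : Measurable f) (c : ℝ) :
    ∫⁻ z, f z = ∫⁻ r in Ioi (0 : ℝ), ∫⁻ θ in Ioc c (c + 2 * π),
      ENNReal.ofReal r * f (polarPt r θ) := by
  have hm : Measurable (fun p : ℝ × ℝ => ENNReal.ofReal p.1 * f (polarPt p.1 p.2)) := by
    have := hf.comp continuous_polarPt.measurable
    exact (ENNReal.measurable_ofReal.comp measurable_fst).mul this
  have h0 : ∀ p : ℝ × ℝ, Complex.polarCoord.symm p = polarPt p.1 p.2 := by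
    intro p
    rw [Complex.polarCoord_symm_apply, polarPt, Complex.exp_mul_I]
    push_cast; rfl
  rw [← Complex.lintegral_comp_polarCoord_symm f]
  simp only [h0, smul_eq_mul, polarCoord_target]
  rw [Measure.volume_eq_prod, ← Measure.prod_restrict, lintegral_prod _ hm.aemeasurable]
  refine lintegral_congr fun r => ?_
  have h1 : ∫⁻ θ in Ioo (-π) π, ENNReal.ofReal r * f (polarPt r θ) =
      ∫⁻ θ in Ioc (-π) (-π + 2 * π), ENNReal.ofReal r * f (polarPt r θ) := by
    rw [show -π + 2 * π = π by ring]
    exact setLIntegral_congr Ioo_ae_eq_Ioc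
  rw [h1]
  exact setLIntegral_Ioc_periodic Real.two_pi_pos _
    (fun θ => by simp only [polarPt_add_two_pi]) _ _

/-- One angle is in the open window and the other in the closed one, because a full-length closed
arc counts its endpoint twice. -/
lemma polarPt_inj {r r' θ t c : ℝ} (hr : 0 < r) (hr' : 0 ≤ r') (hθ : θ ∈ Ioo c (c + 2 * π))
    (ht : t ∈ Icc c (c + 2 * π)) (h : polarPt r θ = polarPt r' t) : r = r' ∧ θ = t := by
  have h1 : r = r' := by
    have := congrArg norm h
    simpa [abs_of_pos hr, abs_of_nonneg hr'] using this
  refine ⟨h1, ?_⟩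
  subst h1
  unfold polarPt at h
  have h2 := mul_left_cancel₀ (by exact_mod_cast hr.ne') h
  obtain ⟨n, hn⟩ := Complex.exp_eq_exp_iff_exists_int.1 h2
  have h3 : ((θ : ℝ) : ℂ) = ((t + n * (2 * π) : ℝ) : ℂ) := by
    apply mul_right_cancel₀ Complex.I_ne_zero
    rw [hn]; push_cast; ring
  have h4 : θ = t + n * (2 * π) := by exact_mod_cast h3
  have hpi := Real.two_pi_pos
  have h5 : (n : ℝ) < 1 := by
    by_contra hcon
    nlinarith [hθ.2, ht.1]
  have h6 : (-1 : ℝ) < n := by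
    by_contra hcon
    nlinarith [hθ.1, ht.2]
  have : n = 0 := by
    have h5' : n < 1 := by exact_mod_cast h5
    have h6' : -1 < n := by exact_mod_cast h6
    omega
  simp [h4, this]

/-- The square is the continuous image of a compact rectangle, cut by the open disc. -/
lemma measurableSet_carlesonSquare (c ℓ : ℝ) : MeasurableSet (carlesonSquare c ℓ) := by
  have h : carlesonSquare c ℓ =
      (fun p : ℝ × ℝ => polarPt p.1 p.2) '' (Icc (max 0 (1 - ℓ)) 1 ×ˢ Icc c (c + ℓ)) ∩
        Metric.ball 0 1 := by
    ext z
    constructor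
    · rintro ⟨r, t, h0, h1, h2, h3, rfl⟩
      refine ⟨⟨(r, t), ⟨⟨max_le h0 h1, h2.le⟩, h3⟩, rfl⟩, ?_⟩
      simpa [Complex.norm_exp_ofReal_mul_I, abs_of_nonneg h0] using h2
    · rintro ⟨⟨⟨r, t⟩, ⟨⟨h0, h1⟩, h3⟩, rfl⟩, hz⟩
      have hr : 0 ≤ r := (le_max_left _ _).trans h0
      refine ⟨r, t, hr, (le_max_right _ _).trans h0, ?_, h3, rfl⟩
      simpa [abs_of_nonneg hr] using hz
  rw [h]
  exact ((isCompact_Icc.prod isCompact_Icc).image continuous_polarPt).measurableSet.inter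
    Metric.isOpen_ball.measurableSet

lemma polarPt_mem_carlesonSquare_iff {c ℓ r θ : ℝ} (hℓ : ℓ ≤ 2 * π) (hr : 0 < r)
    (hθ : θ ∈ Ioo c (c + 2 * π)) :
    polarPt r θ ∈ carlesonSquare c ℓ ↔ r ∈ Ico (max 0 (1 - ℓ)) 1 ∧ θ ∈ Icc c (c + ℓ) := by
  constructor
  · rintro ⟨r', t, h0, h1, h2, h3, h⟩
    obtain ⟨rfl, rfl⟩ := polarPt_inj hr h0 hθ ⟨h3.1, h3.2.trans (by linarith)⟩ h
    exact ⟨⟨max_le h0 h1, h2⟩, h3⟩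
  · rintro ⟨⟨h0, h1⟩, h3⟩
    exact ⟨r, θ, hr.le, (le_max_right _ _).trans h0, h1, h3, rfl⟩

lemma setLIntegral_carlesonSquare (f : ℂ → ℝ≥0∞) (hf : Measurable f) {c ℓ : ℝ}
    (hℓ : ℓ ≤ 2 * π) :
    ∫⁻ z in carlesonSquare c ℓ, f z = ∫⁻ r in Ioo (max 0 (1 - ℓ)) 1, ∫⁻ θ in Ioo c (c + ℓ),
      ENNReal.ofReal r * f (polarPt r θ) := by
  rw [← lintegral_indicator (measurableSet_carlesonSquare c ℓ),
    lintegral_polar _ (hf.indicator (measurableSet_carlesonSquare c ℓ)) c]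
  have hsub : Ioo (max 0 (1 - ℓ)) 1 ⊆ Ioi (0 : ℝ) := fun x hx =>
    (le_max_left _ _).trans_lt hx.1
  have hsub2 : Ioo c (c + ℓ) ⊆ Ioo c (c + 2 * π) := Ioo_subset_Ioo_right (by linarith)
  rw [← lintegral_indicator measurableSet_Ioo, ← lintegral_indicator measurableSet_Ioi]
  have hne : ∀ᵐ r : ℝ, r ≠ max 0 (1 - ℓ) := by simp [ae_iff, measure_singleton]
  refine lintegral_congr_ae ?_
  filter_upwards [hne] with r hr
  by_cases hr0 : 0 < r
  · rw [indicator_of_mem (show r ∈ Ioi (0 : ℝ) from hr0)]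
    rw [setLIntegral_congr (Ioo_ae_eq_Ioc (a := c) (b := c + 2 * π)).symm]
    by_cases hr1 : r ∈ Ioo (max 0 (1 - ℓ)) 1
    · rw [indicator_of_mem hr1]
      rw [← lintegral_indicator measurableSet_Ioo, ← lintegral_indicator measurableSet_Ioo]
      have hne : ∀ᵐ t : ℝ, t ≠ c + ℓ := by simp [ae_iff, measure_singleton]
      refine lintegral_congr_ae ?_
      filter_upwards [hne] with θ hθ
      by_cases h1 : θ ∈ Ioo c (c + 2 * π)
      · rw [indicator_of_mem h1]
        by_cases h2 : θ ∈ Ioo c (c + ℓ)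
        · rw [indicator_of_mem h2, indicator_of_mem]
          exact (polarPt_mem_carlesonSquare_iff hℓ hr0 h1).2
            ⟨Ioo_subset_Ico_self hr1, Ioo_subset_Icc_self h2⟩
        · rw [indicator_of_notMem h2, indicator_of_notMem, mul_zero]
          intro h3
          have h4 := ((polarPt_mem_carlesonSquare_iff hℓ hr0 h1).1 h3).2
          exact h2 ⟨h1.1, lt_of_le_of_ne h4.2 hθ⟩
      · rw [indicator_of_notMem h1, indicator_of_notMem (fun h => h1 (hsub2 h))]
    · rw [indicator_of_notMem hr1, setLIntegral_eq_zero measurableSet_Ioo]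
      intro θ hθ
      simp only [Pi.zero_apply]
      rw [indicator_of_notMem, mul_zero]
      intro h3
      have h4 := ((polarPt_mem_carlesonSquare_iff hℓ hr0 hθ).1 h3).1
      exact hr1 ⟨lt_of_le_of_ne h4.1 hr.symm, h4.2⟩
  · rw [indicator_of_notMem (show r ∉ Ioi (0 : ℝ) from hr0),
      indicator_of_notMem (fun h => hr0 (hsub h))]

/-! ### Tails and moments of the weight. -/

/-- The tail `∫_r^1 ω(s) s ds`, as an extended number. -/
noncomputable def tailMass (ω : ℝ → ℝ) (r : ℝ) : ℝ≥0∞ :=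
  ∫⁻ s in Ioo r 1, ENNReal.ofReal (ω s * s)

/-- The moment `∫_0^1 ω(s) s^{n+1} ds`, as an extended number. -/
noncomputable def moment (ω : ℝ → ℝ) (n : ℕ) : ℝ≥0∞ :=
  ∫⁻ s in Ioo (0 : ℝ) 1, ENNReal.ofReal (ω s * s ^ (n + 1))

lemma tailMass_antitone (ω : ℝ → ℝ) : Antitone (tailMass ω) := fun _ _ h =>
  lintegral_mono_set (Ioo_subset_Ioo_left h)

lemma measurable_tailMass (ω : ℝ → ℝ) : Measurable (tailMass ω) := (tailMass_antitone ω).measurable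

variable {ω : ℝ → ℝ}

/-- Nothing is known about `ω` off `[0,1)`, so measurability arguments go through its truncation. -/
lemma measurable_indicator_weight (hc : ContinuousOn ω (Ico (0 : ℝ) 1)) :
    Measurable ((Ico (0 : ℝ) 1).indicator ω) := by
  classical
  rw [← piecewise_eq_indicator]
  exact hc.measurable_piecewise continuousOn_const measurableSet_Ico

lemma weightMass_carlesonSquare (hc : ContinuousOn ω (Ico (0 : ℝ) 1)) {c ℓ : ℝ}
    (hℓ : ℓ ≤ 2 * π) : weightMass ω (carlesonSquare c ℓ) =
      ENNReal.ofReal (1 / π) * (ENNReal.ofReal ℓ * tailMass ω (max 0 (1 - ℓ))) := by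
  have hm := measurable_indicator_weight hc
  have h1 : ∀ z ∈ carlesonSquare c ℓ, ENNReal.ofReal (ω ‖z‖) =
      ENNReal.ofReal ((Ico (0 : ℝ) 1).indicator ω ‖z‖) := by
    rintro z ⟨r, t, h0, h1, h2, h3, rfl⟩
    rw [indicator_of_mem]
    simpa [Complex.norm_exp_ofReal_mul_I, abs_of_nonneg h0] using ⟨h0, h2⟩
  rw [weightMass, areaMeasure, Measure.restrict_smul, lintegral_smul_measure, smul_eq_mul,
    setLIntegral_congr_fun (measurableSet_carlesonSquare c ℓ) h1,
    setLIntegral_carlesonSquare (fun z : ℂ => ENNReal.ofReal ((Ico (0 : ℝ) 1).indicator ω ‖z‖))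
      (hm.comp measurable_norm).ennreal_ofReal hℓ]
  congr 1
  have hm' : Measurable fun s : ℝ => ENNReal.ofReal ((Ico (0 : ℝ) 1).indicator ω s * s) :=
    (hm.mul measurable_id).ennreal_ofReal
  have h2 : tailMass ω (max 0 (1 - ℓ)) = ∫⁻ s in Ioo (max 0 (1 - ℓ)) 1,
      ENNReal.ofReal ((Ico (0 : ℝ) 1).indicator ω s * s) := by
    refine setLIntegral_congr_fun measurableSet_Ioo fun s hs => ?_
    rw [indicator_of_mem]
    exact ⟨(le_max_left _ _).trans hs.1.le, hs.2⟩
  rw [h2, ← lintegral_const_mul _ hm']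
  refine setLIntegral_congr_fun measurableSet_Ioo fun r hr => ?_
  have hr0 : 0 < r := (le_max_left _ _).trans_lt hr.1
  simp only [norm_polarPt, abs_of_pos hr0, lintegral_const, Measure.restrict_apply_univ,
    Real.volume_Ioo, add_sub_cancel_left]
  rw [mul_comm, ENNReal.ofReal_mul' hr0.le, mul_comm (ENNReal.ofReal r)]

lemma tailMass_lt_top (hω : IsRadialWeight ω) (hc : ContinuousOn ω (Ico (0 : ℝ) 1)) {r : ℝ}
    (hr : 0 ≤ r) : tailMass ω r < ∞ := by
  refine (tailMass_antitone ω hr).trans_lt ?_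
  have hpi := Real.pi_gt_three
  have h1 : weightMass ω (carlesonSquare 0 (2 * π)) < ∞ := by
    refine lt_of_le_of_lt ?_ hω.integrable.hasFiniteIntegral
    calc weightMass ω (carlesonSquare 0 (2 * π)) ≤ weightMass ω unitDisc := by
          refine lintegral_mono_set ?_
          rintro z ⟨r, t, h0, h1, h2, h3, rfl⟩
          simpa [unitDisc, Complex.norm_exp_ofReal_mul_I, abs_of_nonneg h0] using h2
      _ ≤ _ := lintegral_mono fun z => Real.ofReal_le_enorm _
  rw [weightMass_carlesonSquare hc le_rfl, max_eq_left (by linarith)] at h1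
  by_contra hcon
  rw [not_lt, top_le_iff] at hcon
  rw [hcon, ENNReal.mul_top (by simpa using Real.pi_pos),
    ENNReal.mul_top (by simpa using Real.pi_pos)] at h1
  exact lt_irrefl _ h1

lemma tailMass_pos (hω : IsRadialWeight ω) (hc : ContinuousOn ω (Ico (0 : ℝ) 1)) {r : ℝ}
    (hr : 0 ≤ r) (hr1 : r < 1) : 0 < tailMass ω r := by
  unfold tailMass
  have hcont : ContinuousOn (fun s => ω s * s) (Ioo r 1) :=
    (hc.mono fun x hx => ⟨hr.trans hx.1.le, hx.2⟩).mul continuousOn_id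
  rw [pos_iff_ne_zero, Ne, lintegral_eq_zero_iff'
    (hcont.aemeasurable measurableSet_Ioo).ennreal_ofReal]
  intro h
  have h1 : ∀ᵐ s ∂volume.restrict (Ioo r 1), False := by
    filter_upwards [h, ae_restrict_mem measurableSet_Ioo] with s h2 hs
    have hs0 : 0 < s := hr.trans_lt hs.1
    exact absurd h2 (by simpa using mul_pos (hω.pos s ⟨hs0.le, hs.2⟩) hs0)
  rw [eventually_false_iff_eq_bot, ae_eq_bot, Measure.restrict_eq_zero] at h1
  simp only [Real.volume_Ioo, ENNReal.ofReal_eq_zero] at h1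
  linarith

lemma lintegral_pow (n : ℕ) {s : ℝ} (hs : 0 ≤ s) :
    ∫⁻ r in Ioo 0 s, ENNReal.ofReal (r ^ n) = ENNReal.ofReal (s ^ (n + 1) / (n + 1)) := by
  rw [← ofReal_integral_eq_lintegral_ofReal]
  · rw [← integral_Ioc_eq_integral_Ioo, ← intervalIntegral.integral_of_le hs, integral_pow]
    simp
  · exact ((continuous_pow n).integrableOn_Icc).mono_set Ioo_subset_Icc_self
  · refine (ae_restrict_iff' measurableSet_Ioo).2 (ae_of_all _ fun r hr => ?_)
    exact pow_nonneg hr.1.le n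

/-- Each of the `n` terms of `1 + r + ... + r^(n-1)` is at least `r^(n-1)`, and the geometric sum
times `1 - r` is `1 - r^n`. -/
lemma mul_pow_mul_one_sub_le {n : ℕ} {r : ℝ} (h0 : 0 ≤ r) (h1 : r ≤ 1) :
    n * r ^ (n - 1) * (1 - r) ≤ 1 := by
  have h2 : (n : ℝ) * r ^ (n - 1) ≤ ∑ i ∈ Finset.range n, r ^ i := by
    calc (n : ℝ) * r ^ (n - 1) = ∑ i ∈ Finset.range n, r ^ (n - 1) := by simp
      _ ≤ _ := Finset.sum_le_sum fun i hi => pow_le_pow_of_le_one h0 h1 (by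
        have := Finset.mem_range.1 hi; omega)
  calc n * r ^ (n - 1) * (1 - r) ≤ (∑ i ∈ Finset.range n, r ^ i) * (1 - r) :=
        mul_le_mul_of_nonneg_right h2 (by linarith)
    _ = 1 - r ^ n := geom_sum_mul_neg r n
    _ ≤ 1 := by linarith [pow_nonneg h0 n]

/-- Tonelli over `r < s`: since `n r^(n-1) (1 - r) ≤ 1`, the inner integral is at most `∫_0^s n
r^(n-1) dr = s^n`. This is the cost of the monomial `z^n` in the radial integral. -/
lemma lintegral_tailMass_le_moment (hc : ContinuousOn ω (Ico (0 : ℝ) 1)) {n : ℕ} (hn : 1 ≤ n) :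
    ∫⁻ r in Ioo (0 : ℝ) 1, ENNReal.ofReal ((n * r ^ (n - 1)) ^ 2 * (1 - r)) * tailMass ω r ≤
      moment ω n := by
  set w := (Ico (0 : ℝ) 1).indicator ω with hw
  have hm : Measurable w := measurable_indicator_weight hc
  set q : ℝ → ℝ≥0∞ := fun r => ENNReal.ofReal ((n * r ^ (n - 1)) ^ 2 * (1 - r)) with hq
  have hqm : Measurable q := by
    refine Measurable.ennreal_ofReal (Continuous.measurable ?_)
    fun_prop
  have hset : MeasurableSet {p : ℝ × ℝ | p.1 < p.2} := measurableSet_lt measurable_fst measurable_snd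
  set h : ℝ → ℝ → ℝ≥0∞ := fun r s =>
    {p : ℝ × ℝ | p.1 < p.2}.indicator (fun p => q p.1 * ENNReal.ofReal (w p.2 * p.2)) (r, s) with hh
  have hmeas : Measurable (Function.uncurry h) := by
    refine Measurable.indicator ?_ hset
    exact (hqm.comp measurable_fst).mul
      (((hm.comp measurable_snd).mul measurable_snd).ennreal_ofReal)
  have e1 : ∀ r ∈ Ioo (0 : ℝ) 1, q r * tailMass ω r = ∫⁻ s in Ioo (0 : ℝ) 1, h r s := by
    intro r hr
    have hwm : Measurable fun s => ENNReal.ofReal (w s * s) :=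
      (hm.mul measurable_id).ennreal_ofReal
    have : tailMass ω r = ∫⁻ s in Ioo r 1, ENNReal.ofReal (w s * s) := by
      refine setLIntegral_congr_fun measurableSet_Ioo fun s hs => ?_
      simp only [hw]
      rw [indicator_of_mem]
      exact ⟨hr.1.le.trans hs.1.le, hs.2⟩
    rw [this, ← lintegral_const_mul _ hwm, ← lintegral_indicator measurableSet_Ioo,
      ← lintegral_indicator measurableSet_Ioo]
    refine lintegral_congr fun s => ?_
    by_cases hs : s ∈ Ioo r 1
    · rw [indicator_of_mem hs, indicator_of_mem (show s ∈ Ioo (0 : ℝ) 1 from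
        ⟨hr.1.trans hs.1, hs.2⟩)]
      simp only [hh]
      rw [indicator_of_mem (show (r, s) ∈ {p : ℝ × ℝ | p.1 < p.2} from hs.1)]
    · rw [indicator_of_notMem hs]
      by_cases hs1 : s ∈ Ioo (0 : ℝ) 1
      · rw [indicator_of_mem hs1]
        simp only [hh]
        rw [indicator_of_notMem]
        exact fun h' => hs ⟨h', hs1.2⟩
      · rw [indicator_of_notMem hs1]
  rw [setLIntegral_congr_fun measurableSet_Ioo e1, lintegral_lintegral_swap hmeas.aemeasurable]
  unfold moment
  refine setLIntegral_mono' measurableSet_Ioo fun s hs => ?_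
  have e2 : ∫⁻ r in Ioo (0 : ℝ) 1, h r s ≤ ∫⁻ r in Ioo 0 s,
      ENNReal.ofReal (w s * s) * ENNReal.ofReal n * ENNReal.ofReal (r ^ (n - 1)) := by
    rw [← lintegral_indicator measurableSet_Ioo, ← lintegral_indicator measurableSet_Ioo]
    refine lintegral_mono fun r => ?_
    by_cases hr : r ∈ Ioo (0 : ℝ) 1
    · rw [indicator_of_mem hr]
      simp only [hh]
      by_cases hrs : r < s
      · rw [indicator_of_mem (show (r, s) ∈ {p : ℝ × ℝ | p.1 < p.2} from hrs),
          indicator_of_mem (show r ∈ Ioo 0 s from ⟨hr.1, hrs⟩), mul_comm, mul_assoc]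
        refine mul_le_mul_right ?_ _
        simp only [hq]
        rw [← ENNReal.ofReal_mul (by positivity)]
        refine ENNReal.ofReal_le_ofReal ?_
        have := mul_pow_mul_one_sub_le (n := n) hr.1.le hr.2.le
        have h3 : 0 ≤ (n : ℝ) * r ^ (n - 1) := mul_nonneg (by positivity) (pow_nonneg hr.1.le _)
        nlinarith
      · rw [indicator_of_notMem (show (r, s) ∉ {p : ℝ × ℝ | p.1 < p.2} from hrs)]
        exact zero_le
    · rw [indicator_of_notMem hr]
      exact zero_le
  refine e2.trans ?_
  rw [lintegral_const_mul _ (by fun_prop), lintegral_pow _ hs.1.le, mul_assoc,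
    ← ENNReal.ofReal_mul (by positivity), hw,
    indicator_of_mem (show s ∈ Ico (0 : ℝ) 1 from ⟨hs.1.le, hs.2⟩),
    ← ENNReal.ofReal_mul' (by have := hs.1; positivity)]
  refine ENNReal.ofReal_le_ofReal (le_of_eq ?_)
  have hn' : ((n - 1 : ℕ) : ℝ) + 1 = n := by exact_mod_cast Nat.sub_add_cancel hn
  rw [hn', Nat.sub_add_cancel hn]
  have : (n : ℝ) ≠ 0 := by positivity
  field_simp
  ring

lemma moment_le_tailMass (hω : IsRadialWeight ω) (n : ℕ) : moment ω n ≤ tailMass ω 0 := by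
  refine setLIntegral_mono' measurableSet_Ioo fun s hs => ENNReal.ofReal_le_ofReal ?_
  refine mul_le_mul_of_nonneg_left ?_ (hω.pos s ⟨hs.1.le, hs.2⟩).le
  exact pow_le_of_le_one hs.1.le hs.2.le (by omega)

/-- Split the moment at `r = 1 - ℓ`. Above `r` it is at most the tail. Below, `ω ≤ C ω(r)` and `∫
s^(n+1) ≤ 1/(n+2) ≤ ℓ`, while the tail itself is at least `ω(r) ℓ / (2C)`. Essential monotonicity of
`ω` enters only here. -/
lemma moment_le_mul_tailMass (hω : IsRadialWeight ω) (hinc : EssentiallyIncreasing ω) :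
    ∃ K : ℝ≥0, ∀ (n : ℕ) (ℓ : ℝ), 0 < ℓ → 1 ≤ n * ℓ →
      moment ω n ≤ K * tailMass ω (max 0 (1 - ℓ)) := by
  obtain ⟨C, hC, hinc⟩ := hinc
  -- The `1` pays for the part above `r` and for the case `ℓ ≥ 1`; `2C²` is the ratio of `C ω(r) ℓ`
  -- to `ω(r) ℓ / (2C)`.
  refine ⟨1 + Real.toNNReal (2 * C ^ 2), fun n ℓ hℓ hn => ?_⟩
  have hK : (1 : ℝ≥0∞) ≤ ((1 + Real.toNNReal (2 * C ^ 2) : ℝ≥0) : ℝ≥0∞) := by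
    exact_mod_cast le_self_add
  rcases le_or_gt 1 ℓ with h1 | h1
  · rw [max_eq_left (by linarith)]
    calc moment ω n ≤ 1 * tailMass ω 0 := by rw [one_mul]; exact moment_le_tailMass hω n
      _ ≤ _ := mul_le_mul_left hK _
  rw [max_eq_right (by linarith)]
  set r := 1 - ℓ with hr
  have hr0 : 0 < r := by linarith
  have hr1 : r < 1 := by linarith
  have hωr := hω.pos r ⟨hr0.le, hr1⟩
  have htail : ENNReal.ofReal (ω r * ℓ / (2 * C)) ≤ tailMass ω r := by
    calc ENNReal.ofReal (ω r * ℓ / (2 * C)) ≤ ENNReal.ofReal (ω r / C * ((1 + r) / 2 * ℓ)) := by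
          refine ENNReal.ofReal_le_ofReal ?_
          have : ω r / C * ((1 + r) / 2 * ℓ) - ω r * ℓ / (2 * C) = ω r / C * (r / 2 * ℓ) := by
            field_simp; ring
          have h2 : 0 ≤ ω r / C * (r / 2 * ℓ) := by positivity
          linarith
      _ = ∫⁻ s in Ioo r 1, ENNReal.ofReal (ω r / C * s) := by
          rw [← ofReal_integral_eq_lintegral_ofReal]
          · rw [← integral_Ioc_eq_integral_Ioo, ← intervalIntegral.integral_of_le hr1.le,
              intervalIntegral.integral_const_mul, integral_id]
            congr 2
            rw [hr]; ring
          · exact ((continuous_const.mul continuous_id).integrableOn_Icc).mono_set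
              Ioo_subset_Icc_self
          · refine (ae_restrict_iff' measurableSet_Ioo).2 (ae_of_all _ fun s hs => ?_)
            have : 0 < s := hr0.trans hs.1
            show (0 : ℝ) ≤ ω r / C * s
            positivity
      _ ≤ tailMass ω r := by
          refine setLIntegral_mono' measurableSet_Ioo fun s hs => ENNReal.ofReal_le_ofReal ?_
          refine mul_le_mul_of_nonneg_right ?_ (hr0.trans hs.1).le
          rw [div_le_iff₀ hC, mul_comm]
          exact hinc r s hr0.le hs.1.le hs.2
  have hlow : ∫⁻ s in Ioc 0 r, ENNReal.ofReal (ω s * s ^ (n + 1)) ≤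
      ENNReal.ofReal (C * ω r * ℓ) := by
    calc ∫⁻ s in Ioc 0 r, ENNReal.ofReal (ω s * s ^ (n + 1))
        ≤ ∫⁻ s in Ioc 0 r, ENNReal.ofReal (C * ω r) * ENNReal.ofReal (s ^ (n + 1)) := by
          refine setLIntegral_mono' measurableSet_Ioc fun s hs => ?_
          rw [← ENNReal.ofReal_mul (by positivity)]
          refine ENNReal.ofReal_le_ofReal ?_
          exact mul_le_mul_of_nonneg_right (hinc s r hs.1.le hs.2 hr1) (pow_nonneg hs.1.le _)
      _ ≤ ∫⁻ s in Ioo (0 : ℝ) 1, ENNReal.ofReal (C * ω r) * ENNReal.ofReal (s ^ (n + 1)) :=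
          lintegral_mono_set fun s hs => ⟨hs.1, hs.2.trans_lt hr1⟩
      _ = ENNReal.ofReal (C * ω r * (1 ^ (n + 1 + 1) / ((n + 1 : ℕ) + 1))) := by
          rw [lintegral_const_mul _ (by fun_prop), lintegral_pow _ zero_le_one,
            ← ENNReal.ofReal_mul (by positivity)]
      _ ≤ ENNReal.ofReal (C * ω r * ℓ) := by
          refine ENNReal.ofReal_le_ofReal (mul_le_mul_of_nonneg_left ?_ (by positivity))
          rw [one_pow, div_le_iff₀ (by positivity)]
          push_cast
          nlinarith
  have hsplit : moment ω n ≤ (∫⁻ s in Ioc 0 r, ENNReal.ofReal (ω s * s ^ (n + 1))) +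
      ∫⁻ s in Ioo r 1, ENNReal.ofReal (ω s * s ^ (n + 1)) := by
    unfold moment
    rw [← Ioc_union_Ioo_eq_Ioo hr0.le hr1]
    exact lintegral_union_le _ _ _
  have hhigh : ∫⁻ s in Ioo r 1, ENNReal.ofReal (ω s * s ^ (n + 1)) ≤ tailMass ω r := by
    refine setLIntegral_mono' measurableSet_Ioo fun s hs => ENNReal.ofReal_le_ofReal ?_
    have hs0 := hr0.trans hs.1
    refine mul_le_mul_of_nonneg_left ?_ (hω.pos s ⟨hs0.le, hs.2⟩).le
    exact pow_le_of_le_one hs0.le hs.2.le (by omega)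
  have hlow2 : ENNReal.ofReal (C * ω r * ℓ) ≤ (Real.toNNReal (2 * C ^ 2) : ℝ≥0∞) * tailMass ω r := by
    calc ENNReal.ofReal (C * ω r * ℓ) = ENNReal.ofReal (2 * C ^ 2 * (ω r * ℓ / (2 * C))) := by
          congr 1; field_simp
      _ = ENNReal.ofReal (2 * C ^ 2) * ENNReal.ofReal (ω r * ℓ / (2 * C)) :=
          ENNReal.ofReal_mul (by positivity)
      _ ≤ _ := by
          gcongr
          rfl
  push_cast
  calc moment ω n ≤ _ := hsplit
    _ ≤ (Real.toNNReal (2 * C ^ 2) : ℝ≥0∞) * tailMass ω r + tailMass ω r :=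
        add_le_add (hlow.trans hlow2) hhigh
    _ = _ := by ring

/-! ### The doubling condition and two-sided bounds for `ω^⋆`. -/

lemma integral_eq_toReal_tailMass (hω : IsRadialWeight ω) (hc : ContinuousOn ω (Ico (0 : ℝ) 1))
    {r : ℝ} (hr : 0 ≤ r) (hr1 : r ≤ 1) : ∫ s in r..1, ω s * s = (tailMass ω r).toReal := by
  rw [intervalIntegral.integral_of_le hr1, integral_Ioc_eq_integral_Ioo,
    integral_eq_lintegral_of_nonneg_ae, tailMass]
  · refine (ae_restrict_iff' measurableSet_Ioo).2 (ae_of_all _ fun s hs => ?_)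
    have hs0 := hr.trans hs.1.le
    exact mul_nonneg (hω.pos s ⟨hs0, hs.2⟩).le hs0
  · refine ContinuousOn.aestronglyMeasurable ?_ measurableSet_Ioo
    exact (hc.mono fun x hx => ⟨hr.trans hx.1.le, hx.2⟩).mul continuousOn_id

/-- Since `1 - 2r/(1+r²) = (1-r)²/(1+r²) ≤ (1-r)²`, one use of the hypothesis reaches every point
whose distance to 1 is at least the square of that of `r`. -/
lemma tailMass_le_of_doubling (hω : IsRadialWeight ω) (hc : ContinuousOn ω (Ico (0 : ℝ) 1))
    {C : ℝ} (hC : 0 < C) (hd : ∀ r : ℝ, 0 ≤ r → r < 1 →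
      (∫ s in r..1, ω s * s) ≤ C * ∫ s in (2 * r / (1 + r ^ 2))..1, ω s * s)
    {r s : ℝ} (hr : 0 ≤ r) (hr1 : r < 1) (hs : (1 - r) ^ 2 ≤ 1 - s) :
    tailMass ω r ≤ ENNReal.ofReal C * tailMass ω s := by
  set t := 2 * r / (1 + r ^ 2) with ht
  have ht0 : 0 ≤ t := by positivity
  have ht1 : 1 - t = (1 - r) ^ 2 / (1 + r ^ 2) := by
    rw [ht]; field_simp; ring
  have ht2 : 1 - t ≤ (1 - r) ^ 2 := by
    rw [ht1]; exact div_le_self (by positivity) (by nlinarith [sq_nonneg r])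
  have ht3 : 0 < 1 - t := by
    rw [ht1]; have : 0 < 1 - r := by linarith
    positivity
  have h1 := hd r hr hr1
  rw [integral_eq_toReal_tailMass hω hc hr hr1.le,
    integral_eq_toReal_tailMass hω hc ht0 (by linarith)] at h1
  calc tailMass ω r = ENNReal.ofReal (tailMass ω r).toReal :=
        (ENNReal.ofReal_toReal (tailMass_lt_top hω hc hr).ne).symm
    _ ≤ ENNReal.ofReal (C * (tailMass ω t).toReal) := ENNReal.ofReal_le_ofReal h1
    _ = ENNReal.ofReal C * tailMass ω t := by
        rw [ENNReal.ofReal_mul hC.le, ENNReal.ofReal_toReal (tailMass_lt_top hω hc ht0).ne]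
    _ ≤ _ := by
        gcongr
        exact tailMass_antitone ω (by linarith)

lemma associatedWeight_eq_toReal (hω : IsRadialWeight ω) (hc : ContinuousOn ω (Ico (0 : ℝ) 1))
    {z : ℂ} (h0 : 0 < ‖z‖) (h1 : ‖z‖ < 1) : associatedWeight ω z =
      (∫⁻ s in Ioo ‖z‖ 1, ENNReal.ofReal (ω s * Real.log (s / ‖z‖) * s)).toReal := by
  rw [associatedWeight, intervalIntegral.integral_of_le h1.le, integral_Ioc_eq_integral_Ioo,
    integral_eq_lintegral_of_nonneg_ae]
  · refine (ae_restrict_iff' measurableSet_Ioo).2 (ae_of_all _ fun s hs => ?_)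
    have hs0 := h0.trans hs.1
    refine mul_nonneg (mul_nonneg (hω.pos s ⟨hs0.le, hs.2⟩).le (Real.log_nonneg ?_)) hs0.le
    rw [le_div_iff₀ h0]; linarith [hs.1]
  · refine ContinuousOn.aestronglyMeasurable ?_ measurableSet_Ioo
    refine ((hc.mono fun x hx => ⟨h0.le.trans hx.1.le, hx.2⟩).mul ?_).mul continuousOn_id
    refine ContinuousOn.log (by fun_prop) fun s hs => ?_
    exact (div_pos (h0.trans hs.1) h0).ne'

lemma lintegral_log_le (hω : IsRadialWeight ω) {x : ℝ} (h0 : 0 < x) (h1 : x < 1) :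
    ∫⁻ s in Ioo x 1, ENNReal.ofReal (ω s * Real.log (s / x) * s) ≤
      ENNReal.ofReal ((1 - x) / x) * tailMass ω x := by
  rw [tailMass, ← lintegral_const_mul' _ _ ENNReal.ofReal_ne_top]
  refine setLIntegral_mono' measurableSet_Ioo fun s hs => ?_
  have hs0 := h0.trans hs.1
  have h2 : 0 ≤ (1 - x) / x := div_nonneg (by linarith) h0.le
  rw [← ENNReal.ofReal_mul h2]
  refine ENNReal.ofReal_le_ofReal ?_
  have h3 : Real.log (s / x) ≤ (1 - x) / x := by
    calc Real.log (s / x) ≤ s / x - 1 := Real.log_le_sub_one_of_pos (div_pos hs0 h0)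
      _ ≤ 1 / x - 1 := by gcongr; exact hs.2.le
      _ = _ := by field_simp
  have h4 := hω.pos s ⟨hs0.le, hs.2⟩
  calc ω s * Real.log (s / x) * s = Real.log (s / x) * (ω s * s) := by ring
    _ ≤ _ := mul_le_mul_of_nonneg_right h3 (by positivity)

/-- From `log x ≤ x - 1`. The factor `1/‖z‖` is later cancelled by the polar Jacobian. -/
lemma ofReal_associatedWeight_le (hω : IsRadialWeight ω) (hc : ContinuousOn ω (Ico (0 : ℝ) 1))
    {z : ℂ} (h0 : 0 < ‖z‖) (h1 : ‖z‖ < 1) : ENNReal.ofReal (associatedWeight ω z) ≤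
      ENNReal.ofReal ((1 - ‖z‖) / ‖z‖) * tailMass ω ‖z‖ := by
  rw [associatedWeight_eq_toReal hω hc h0 h1]
  exact ENNReal.ofReal_toReal_le.trans (lintegral_log_le hω h0 h1)

/-- For `s` beyond the midpoint of `‖z‖` and 1, `log(s/‖z‖) ≥ 1 - ‖z‖/s ≥ (1 - ‖z‖)/2`. -/
lemma le_ofReal_associatedWeight (hω : IsRadialWeight ω) (hc : ContinuousOn ω (Ico (0 : ℝ) 1))
    {z : ℂ} (h0 : 0 < ‖z‖) (h1 : ‖z‖ < 1) :
    ENNReal.ofReal ((1 - ‖z‖) / 2) * tailMass ω ((1 + ‖z‖) / 2) ≤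
      ENNReal.ofReal (associatedWeight ω z) := by
  rw [associatedWeight_eq_toReal hω hc h0 h1, ENNReal.ofReal_toReal]
  · rw [tailMass, ← lintegral_const_mul' _ _ ENNReal.ofReal_ne_top]
    refine le_trans ?_ (lintegral_mono_set
      (Ioo_subset_Ioo_left (show ‖z‖ ≤ (1 + ‖z‖) / 2 by linarith)))
    refine setLIntegral_mono' measurableSet_Ioo fun s hs => ?_
    rw [← ENNReal.ofReal_mul (by linarith)]
    refine ENNReal.ofReal_le_ofReal ?_
    have hs0 : 0 < s := by linarith [hs.1]
    have h3 : (1 - ‖z‖) / 2 ≤ Real.log (s / ‖z‖) := by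
      have h5 := Real.one_sub_inv_le_log_of_pos (div_pos hs0 h0)
      refine le_trans ?_ h5
      rw [inv_div, le_sub_iff_add_le, ← le_sub_iff_add_le', div_le_iff₀ hs0]
      nlinarith [hs.1, hs.2]
    have h4 := hω.pos s ⟨hs0.le, hs.2⟩
    calc (1 - ‖z‖) / 2 * (ω s * s) ≤ Real.log (s / ‖z‖) * (ω s * s) :=
          mul_le_mul_of_nonneg_right h3 (by positivity)
      _ = _ := by ring
  · exact ((lintegral_log_le hω h0 h1).trans_lt
      (ENNReal.mul_lt_top ENNReal.ofReal_lt_top (tailMass_lt_top hω hc h0.le))).ne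

/-! ### Lacunary polynomials and the upper bound on Carleson squares. -/

/-- The lacunary polynomial `∑ b_k z^{2^k}`. -/
noncomputable def lacunary (b : ℕ → ℝ) (s : Finset ℕ) (z : ℂ) : ℂ :=
  ∑ k ∈ s, (b k : ℂ) * z ^ (2 ^ k)

/-- The derivative `∑ b_k 2^k z^{2^k - 1}` of a lacunary polynomial. -/
noncomputable def lacunaryDeriv (b : ℕ → ℝ) (s : Finset ℕ) (z : ℂ) : ℂ :=
  ∑ k ∈ s, (b k : ℂ) * (2 ^ k * z ^ (2 ^ k - 1))

lemma hasDerivAt_lacunary (b : ℕ → ℝ) (s : Finset ℕ) (z : ℂ) :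
    HasDerivAt (lacunary b s) (lacunaryDeriv b s z) z := by
  unfold lacunary lacunaryDeriv
  refine HasDerivAt.fun_sum fun k _ => ?_
  simpa using (hasDerivAt_pow (2 ^ k) z).const_mul (b k : ℂ)

@[fun_prop]
lemma continuous_lacunaryDeriv (b : ℕ → ℝ) (s : Finset ℕ) : Continuous (lacunaryDeriv b s) := by
  unfold lacunaryDeriv; fun_prop

/-- The unimodular factor shifts the frequencies `2^k - 1` to `2^k`, so those with `k ≥ m` are
multiples of `2^m`. -/
lemma lacunaryDeriv_polarPt_mul (b : ℕ → ℝ) (s : Finset ℕ) (r θ : ℝ) :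
    lacunaryDeriv b s (polarPt r θ) * Complex.exp (θ * Complex.I) =
      ∑ k ∈ s, ((b k * (2 ^ k * r ^ (2 ^ k - 1)) : ℝ) : ℂ) *
        Complex.exp ((2 ^ k : ℕ) * (θ * Complex.I)) := by
  unfold lacunaryDeriv
  rw [Finset.sum_mul]
  refine Finset.sum_congr rfl fun k _ => ?_
  rw [Complex.exp_nat_mul, polarPt, mul_pow]
  have : Complex.exp (θ * Complex.I) ^ (2 ^ k) =
      Complex.exp (θ * Complex.I) ^ (2 ^ k - 1) * Complex.exp (θ * Complex.I) := by
    rw [← pow_succ, Nat.sub_add_cancel Nat.one_le_two_pow]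
  rw [this]
  push_cast
  ring

/-- The frequency difference is a multiple of `2^m`, so the interval contains a whole number of
periods. -/
lemma integral_exp_two_pow_sub {m j k : ℕ} (hj : m ≤ j) (hk : m ≤ k) (c : ℝ) :
    ∫ θ in c..(c + 2 * π / 2 ^ m), Complex.exp (((2 ^ j - 2 ^ k : ℝ) * Complex.I : ℂ) * θ) =
      if j = k then ((2 * π / 2 ^ m : ℝ) : ℂ) else 0 := by
  split_ifs with h
  · subst h
    simp
  · have hne : (((2 ^ j - 2 ^ k : ℝ) : ℂ) * Complex.I) ≠ 0 := by
      refine mul_ne_zero ?_ Complex.I_ne_zero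
      intro h1
      have h2 : (2 : ℝ) ^ j = 2 ^ k := sub_eq_zero.1 (by exact_mod_cast h1)
      exact h (pow_right_injective₀ (by norm_num) (by norm_num) h2)
    rw [integral_exp_mul_complex hne, div_eq_zero_iff]
    left
    rw [sub_eq_zero, Complex.exp_eq_exp_iff_exists_int]
    obtain ⟨p, rfl⟩ := Nat.exists_eq_add_of_le hj
    obtain ⟨q, rfl⟩ := Nat.exists_eq_add_of_le hk
    refine ⟨2 ^ p - 2 ^ q, ?_⟩
    push_cast
    field_simp
    ring

/-- Parseval localized to a short arc, available because only frequencies divisible by `2^m` occur.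
-/
lemma integral_norm_sq_lacunaryDeriv (b : ℕ → ℝ) {s : Finset ℕ} {m : ℕ} (hs : ∀ k ∈ s, m ≤ k)
    (r c : ℝ) : ∫ θ in c..(c + 2 * π / 2 ^ m), ‖lacunaryDeriv b s (polarPt r θ)‖ ^ 2 =
      2 * π / 2 ^ m * ∑ k ∈ s, (b k * (2 ^ k * r ^ (2 ^ k - 1))) ^ 2 := by
  set β : ℕ → ℝ := fun k => b k * (2 ^ k * r ^ (2 ^ k - 1)) with hβ
  have h1 : ∀ θ : ℝ, ((‖lacunaryDeriv b s (polarPt r θ)‖ ^ 2 : ℝ) : ℂ) =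
      ∑ j ∈ s, ∑ k ∈ s, ((β j * β k : ℝ) : ℂ) *
        Complex.exp (((2 ^ j - 2 ^ k : ℝ) * Complex.I : ℂ) * θ) := by
    intro θ
    have h2 : ‖lacunaryDeriv b s (polarPt r θ)‖ =
        ‖lacunaryDeriv b s (polarPt r θ) * Complex.exp (θ * Complex.I)‖ := by
      rw [norm_mul, Complex.norm_exp_ofReal_mul_I, mul_one]
    rw [h2, lacunaryDeriv_polarPt_mul]
    push_cast
    rw [← Complex.mul_conj', map_sum, Finset.sum_mul_sum]
    refine Finset.sum_congr rfl fun j _ => Finset.sum_congr rfl fun k _ => ?_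
    rw [map_mul, ← Complex.exp_conj]
    simp only [map_mul, Complex.conj_ofReal, Complex.conj_I, map_pow, Complex.conj_ofNat, hβ]
    have : Complex.exp (((2 ^ j - 2 ^ k : ℂ) * Complex.I) * θ) =
        Complex.exp (2 ^ j * (θ * Complex.I)) * Complex.exp (2 ^ k * (θ * -Complex.I)) := by
      rw [← Complex.exp_add]
      congr 1; ring
    rw [this]
    push_cast
    ring
  have h3 : ((∫ θ in c..(c + 2 * π / 2 ^ m), ‖lacunaryDeriv b s (polarPt r θ)‖ ^ 2 : ℝ) : ℂ) =
      ((2 * π / 2 ^ m * ∑ k ∈ s, (β k) ^ 2 : ℝ) : ℂ) := by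
    rw [← intervalIntegral.integral_ofReal]
    simp only [h1]
    rw [intervalIntegral.integral_finsetSum]
    swap
    · intro j _
      refine Continuous.intervalIntegrable ?_ _ _
      fun_prop
    push_cast
    rw [Finset.mul_sum]
    refine Finset.sum_congr rfl fun j hj => ?_
    rw [intervalIntegral.integral_finsetSum]
    swap
    · intro j _
      refine Continuous.intervalIntegrable ?_ _ _
      fun_prop
    have h4 : ∀ k ∈ s, ∫ θ in c..(c + 2 * π / 2 ^ m), ((β j : ℂ) * (β k : ℂ)) *
        Complex.exp (((2 ^ j - 2 ^ k : ℂ) * Complex.I : ℂ) * θ) =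
        if j = k then (β j : ℂ) * (β k : ℂ) * ((2 * π / 2 ^ m : ℝ) : ℂ) else 0 := by
      intro k hk
      rw [intervalIntegral.integral_const_mul]
      have := integral_exp_two_pow_sub (hs j hj) (hs k hk) c
      push_cast at this ⊢
      rw [this]
      split_ifs <;> simp
    rw [Finset.sum_congr rfl h4, Finset.sum_ite_eq, if_pos hj]
    push_cast
    ring
  exact Complex.ofReal_injective h3

lemma lintegral_norm_sq_lacunaryDeriv (b : ℕ → ℝ) {s : Finset ℕ} {m : ℕ} (hs : ∀ k ∈ s, m ≤ k)
    (r c : ℝ) : ∫⁻ θ in Ioo c (c + 2 * π / 2 ^ m),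
        ENNReal.ofReal (‖lacunaryDeriv b s (polarPt r θ)‖ ^ 2) =
      ENNReal.ofReal (2 * π / 2 ^ m * ∑ k ∈ s, (b k * (2 ^ k * r ^ (2 ^ k - 1))) ^ 2) := by
  have hT : c ≤ c + 2 * π / 2 ^ m := by
    have := Real.two_pi_pos
    have : 0 ≤ 2 * π / 2 ^ m := by positivity
    linarith
  rw [← integral_norm_sq_lacunaryDeriv b hs r c, intervalIntegral.integral_of_le hT,
    integral_Ioc_eq_integral_Ioo, ofReal_integral_eq_lintegral_ofReal]
  · refine (Continuous.integrableOn_Icc ?_).mono_set Ioo_subset_Icc_self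
    fun_prop
  · exact ae_of_all _ fun θ => by positivity

lemma norm_lacunaryDeriv_le {b : ℕ → ℝ} (hb : ∀ k, |b k| ≤ 1) {s : Finset ℕ} {m : ℕ}
    (hs : ∀ k ∈ s, k < m) {z : ℂ} (hz : ‖z‖ ≤ 1) : ‖lacunaryDeriv b s z‖ ≤ 2 ^ m := by
  calc ‖lacunaryDeriv b s z‖ ≤ ∑ k ∈ s, (2 : ℝ) ^ k := by
        refine norm_sum_le_of_le _ fun k _ => ?_
        rw [norm_mul, norm_mul, norm_pow, norm_pow, Complex.norm_ofNat, Complex.norm_real,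
          Real.norm_eq_abs]
        have h1 : ‖z‖ ^ (2 ^ k - 1) ≤ 1 := pow_le_one₀ (norm_nonneg _) hz
        calc |b k| * (2 ^ k * ‖z‖ ^ (2 ^ k - 1)) ≤ 1 * (2 ^ k * 1) := by
              gcongr
              exact hb k
          _ = 2 ^ k := by ring
    _ ≤ ∑ k ∈ Finset.range m, (2 : ℝ) ^ k :=
        Finset.sum_le_sum_of_subset_of_nonneg (fun k hk => Finset.mem_range.2 (hs k hk))
          fun _ _ _ => by positivity
    _ ≤ 2 ^ m := by
        have := mul_neg_geom_sum (2 : ℝ) m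
        linarith

/-- Split at frequency `2^m`: the low part is at most `2^m` pointwise; for the high part, enlarge
the arc to length `2π/2^m` and use orthogonality. -/
lemma lintegral_norm_sq_lacunaryDeriv_le {b : ℕ → ℝ} (hb : ∀ k, |b k| ≤ 1) (s : Finset ℕ) {m : ℕ}
    {r c ℓ : ℝ} (hr : r ∈ Icc (0 : ℝ) 1) (hℓ : ℓ ≤ 2 * π / 2 ^ m) :
    ∫⁻ θ in Ioo c (c + ℓ), ENNReal.ofReal (‖lacunaryDeriv b s (polarPt r θ)‖ ^ 2) ≤
      ENNReal.ofReal (2 * (2 ^ m) ^ 2 * ℓ) +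
      ENNReal.ofReal (4 * π / 2 ^ m * ∑ k ∈ s with m ≤ k, (b k * (2 ^ k * r ^ (2 ^ k - 1))) ^ 2) := by
  have h1 : ∀ θ, ENNReal.ofReal (‖lacunaryDeriv b s (polarPt r θ)‖ ^ 2) ≤
      ENNReal.ofReal (2 * (2 ^ m) ^ 2) + ENNReal.ofReal 2 *
        ENNReal.ofReal (‖lacunaryDeriv b {k ∈ s | m ≤ k} (polarPt r θ)‖ ^ 2) := by
    intro θ
    rw [← ENNReal.ofReal_mul (by norm_num), ← ENNReal.ofReal_add (by positivity) (by positivity)]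
    refine ENNReal.ofReal_le_ofReal ?_
    have h2 : lacunaryDeriv b s (polarPt r θ) = lacunaryDeriv b {k ∈ s | m ≤ k} (polarPt r θ) +
        lacunaryDeriv b {k ∈ s | ¬ m ≤ k} (polarPt r θ) :=
      (Finset.sum_filter_add_sum_filter_not s _ _).symm
    have h3 : ‖lacunaryDeriv b {k ∈ s | ¬ m ≤ k} (polarPt r θ)‖ ≤ 2 ^ m :=
      norm_lacunaryDeriv_le hb (fun k hk => not_le.1 (Finset.mem_filter.1 hk).2)
        (by simpa [abs_of_nonneg hr.1] using hr.2)
    have h4 := norm_add_le (lacunaryDeriv b {k ∈ s | m ≤ k} (polarPt r θ))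
      (lacunaryDeriv b {k ∈ s | ¬ m ≤ k} (polarPt r θ))
    rw [h2]
    set x := ‖lacunaryDeriv b {k ∈ s | m ≤ k} (polarPt r θ)‖
    set y := ‖lacunaryDeriv b {k ∈ s | ¬ m ≤ k} (polarPt r θ)‖
    have hx : 0 ≤ x := norm_nonneg _
    have hy : 0 ≤ y := norm_nonneg _
    calc _ ≤ (x + y) ^ 2 := pow_le_pow_left₀ (norm_nonneg _) h4 2
      _ ≤ 2 * y ^ 2 + 2 * x ^ 2 := by nlinarith [sq_nonneg (x - y)]
      _ ≤ _ := by gcongr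
  refine (lintegral_mono h1).trans ?_
  rw [lintegral_add_left measurable_const, lintegral_const_mul' _ _ ENNReal.ofReal_ne_top]
  refine add_le_add ?_ ?_
  · simp only [lintegral_const, Measure.restrict_apply_univ, Real.volume_Ioo, add_sub_cancel_left]
    rw [ENNReal.ofReal_mul (p := 2 * (2 ^ m) ^ 2) (by positivity)]
  · refine (mul_le_mul_right (lintegral_mono_set
      (Ioo_subset_Ioo_right (add_le_add_right hℓ c))) _).trans ?_
    rw [lintegral_norm_sq_lacunaryDeriv b (fun k hk => (Finset.mem_filter.1 hk).2),
      ← ENNReal.ofReal_mul (by norm_num)]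
    refine ENNReal.ofReal_le_ofReal (le_of_eq ?_)
    ring

lemma lintegral_one_sub_mul_tailMass_le (hc : ContinuousOn ω (Ico (0 : ℝ) 1)) (b : ℕ → ℝ)
    (s : Finset ℕ) {m : ℕ}
    (hs : ∑ k ∈ s, ENNReal.ofReal (b k ^ 2) * moment ω (2 ^ k) ≤ moment ω (2 ^ m)) :
    ∫⁻ r in Ioo (0 : ℝ) 1, ENNReal.ofReal (1 - r) * tailMass ω r *
      ENNReal.ofReal (∑ k ∈ s, (b k * (2 ^ k * r ^ (2 ^ k - 1))) ^ 2) ≤ moment ω (2 ^ m) := by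
  have hmt := measurable_tailMass ω
  calc _ = ∫⁻ r in Ioo (0 : ℝ) 1, ∑ k ∈ s, ENNReal.ofReal (b k ^ 2) *
        (ENNReal.ofReal ((((2 ^ k : ℕ) : ℝ) * r ^ (2 ^ k - 1)) ^ 2 * (1 - r)) * tailMass ω r) := by
        refine setLIntegral_congr_fun measurableSet_Ioo fun r hr => ?_
        rw [ENNReal.ofReal_sum_of_nonneg (fun _ _ => by positivity), Finset.mul_sum]
        refine Finset.sum_congr rfl fun k _ => ?_
        have h1 : 0 ≤ 1 - r := by linarith [hr.2]
        push_cast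
        rw [mul_pow (b k), ENNReal.ofReal_mul (by positivity), ENNReal.ofReal_mul (by positivity)]
        ring
    _ = ∑ k ∈ s, ENNReal.ofReal (b k ^ 2) * ∫⁻ r in Ioo (0 : ℝ) 1,
        (ENNReal.ofReal ((((2 ^ k : ℕ) : ℝ) * r ^ (2 ^ k - 1)) ^ 2 * (1 - r)) * tailMass ω r) := by
        rw [lintegral_finsetSum]
        · refine Finset.sum_congr rfl fun k _ => ?_
          rw [lintegral_const_mul' _ _ ENNReal.ofReal_ne_top]
        · intro k _
          fun_prop
    _ ≤ ∑ k ∈ s, ENNReal.ofReal (b k ^ 2) * moment ω (2 ^ k) := by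
        gcongr with k
        exact lintegral_tailMass_le_moment hc Nat.one_le_two_pow
    _ ≤ _ := hs

lemma setLIntegral_carlesonSquare_lacunary_le (hω : IsRadialWeight ω)
    (hc : ContinuousOn ω (Ico (0 : ℝ) 1)) {b : ℕ → ℝ} (hb : ∀ k, |b k| ≤ 1) (s : Finset ℕ) {m : ℕ}
    (hs : ∑ k ∈ s with m ≤ k, ENNReal.ofReal (b k ^ 2) * moment ω (2 ^ k) ≤ moment ω (2 ^ m))
    {c ℓ : ℝ} (h0 : 0 < ℓ) (hℓ : ℓ ≤ 2 * π / 2 ^ m) (hℓ2 : ℓ ≤ 2 * π) :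
    ∫⁻ z in carlesonSquare c ℓ,
        ENNReal.ofReal (‖deriv (lacunary b s) z‖ ^ 2 * associatedWeight ω z) ≤
      ENNReal.ofReal (2 * (2 ^ m) ^ 2 * ℓ) * (ENNReal.ofReal (ℓ ^ 2) * tailMass ω (max 0 (1 - ℓ))) +
        ENNReal.ofReal (4 * π / 2 ^ m) * moment ω (2 ^ m) := by
  set r₀ := max 0 (1 - ℓ) with hr₀
  have hr₀0 : 0 ≤ r₀ := le_max_left _ _
  have hr₀1 : 1 - ℓ ≤ r₀ := le_max_right _ _
  have hmt := measurable_tailMass ω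
  set f : ℂ → ℝ≥0∞ := fun z => ENNReal.ofReal (‖lacunaryDeriv b s z‖ ^ 2) *
    (ENNReal.ofReal ((1 - ‖z‖) / ‖z‖) * tailMass ω ‖z‖) with hf
  have hfm : Measurable f := by
    have h1 : Measurable fun z : ℂ => tailMass ω ‖z‖ := hmt.comp measurable_norm
    have h2 : Measurable fun z : ℂ => ‖lacunaryDeriv b s z‖ ^ 2 := by
      refine Continuous.measurable ?_
      fun_prop
    have h3 : Measurable fun z : ℂ => (1 - ‖z‖) / ‖z‖ := by fun_prop
    exact h2.ennreal_ofReal.mul (h3.ennreal_ofReal.mul h1)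
  have hne : ∀ᵐ z : ℂ, z ≠ 0 := by simp [ae_iff, measure_singleton]
  calc _ ≤ ∫⁻ z in carlesonSquare c ℓ, f z := by
        refine setLIntegral_mono_ae' (measurableSet_carlesonSquare c ℓ) ?_
        filter_upwards [hne] with z hz hzS
        have hz0 : 0 < ‖z‖ := norm_pos_iff.2 hz
        have hz1 : ‖z‖ < 1 := by
          obtain ⟨r, t, h0, h1, h2, h3, rfl⟩ := hzS
          simpa [Complex.norm_exp_ofReal_mul_I, abs_of_nonneg h0] using h2
        rw [(hasDerivAt_lacunary b s z).deriv, ENNReal.ofReal_mul (by positivity)]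
        exact mul_le_mul_right (ofReal_associatedWeight_le hω hc hz0 hz1) _
    _ = ∫⁻ r in Ioo r₀ 1, ENNReal.ofReal (1 - r) * tailMass ω r *
        ∫⁻ θ in Ioo c (c + ℓ), ENNReal.ofReal (‖lacunaryDeriv b s (polarPt r θ)‖ ^ 2) := by
        rw [setLIntegral_carlesonSquare f hfm hℓ2]
        refine setLIntegral_congr_fun measurableSet_Ioo fun r hr => ?_
        have hr0 : 0 < r := hr₀0.trans_lt hr.1
        simp only [hf, norm_polarPt, abs_of_pos hr0]
        rw [← lintegral_const_mul _ (by fun_prop)]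
        refine lintegral_congr fun θ => ?_
        have : ENNReal.ofReal (1 - r) = ENNReal.ofReal r * ENNReal.ofReal ((1 - r) / r) := by
          rw [← ENNReal.ofReal_mul hr0.le]
          congr 1; field_simp
        rw [this]
        ring
    _ ≤ ∫⁻ r in Ioo r₀ 1, (ENNReal.ofReal (2 * (2 ^ m) ^ 2 * ℓ) *
          (ENNReal.ofReal ℓ * tailMass ω r₀) +
        ENNReal.ofReal (4 * π / 2 ^ m) * (ENNReal.ofReal (1 - r) * tailMass ω r *
          ENNReal.ofReal (∑ k ∈ s with m ≤ k, (b k * (2 ^ k * r ^ (2 ^ k - 1))) ^ 2))) := by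
        refine setLIntegral_mono' measurableSet_Ioo fun r hr => ?_
        refine (mul_le_mul_right (lintegral_norm_sq_lacunaryDeriv_le hb s
          ⟨hr₀0.trans hr.1.le, hr.2.le⟩ hℓ) _).trans ?_
        rw [mul_add]
        refine add_le_add ?_ (le_of_eq ?_)
        · rw [mul_comm]
          have h2 : 1 - r ≤ ℓ := by linarith [hr.1]
          gcongr
          exact tailMass_antitone ω hr.1.le
        · rw [ENNReal.ofReal_mul (by positivity)]
          ring
    _ ≤ _ := by
        rw [lintegral_add_left measurable_const]
        refine add_le_add ?_
          ((lintegral_const_mul' _ _ ENNReal.ofReal_ne_top).le.trans (mul_le_mul_right ?_ _))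
        · simp only [lintegral_const, Measure.restrict_apply_univ, Real.volume_Ioo]
          have h2 : ENNReal.ofReal (1 - r₀) ≤ ENNReal.ofReal ℓ :=
            ENNReal.ofReal_le_ofReal (by linarith)
          rw [pow_two ℓ, ENNReal.ofReal_mul h0.le]
          refine (mul_le_mul_right h2 _).trans (le_of_eq ?_)
          ring
        · exact (lintegral_mono_set (Ioo_subset_Ioo_left hr₀0)).trans
            (lintegral_one_sub_mul_tailMass_le hc b _ hs)

/-- Lacunary polynomials whose coefficients are dominated by the moments of the weight are
uniformly bounded in the Carleson seminorm. -/
theorem exists_carlesonSup_lacunary_le (hω : IsRadialWeight ω)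
    (hc : ContinuousOn ω (Ico (0 : ℝ) 1)) (hinc : EssentiallyIncreasing ω) :
    ∃ M : ℝ≥0, ∀ (b : ℕ → ℝ) (s : Finset ℕ), (∀ k, |b k| ≤ 1) →
      (∀ m, ∑ k ∈ s with m ≤ k, ENNReal.ofReal (b k ^ 2) * moment ω (2 ^ k) ≤ moment ω (2 ^ m)) →
      carlesonSup ω (lacunary b s) ≤ M := by
  obtain ⟨K, hK⟩ := moment_le_mul_tailMass hω hinc
  refine ⟨Real.toNNReal (8 * π ^ 2) + 4 * K, fun b s hb hs => ?_⟩
  refine iSup_le fun c => iSup_le fun ℓ => iSup_le fun ⟨h0, hℓ2⟩ => ?_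
  refine ENNReal.div_le_of_le_mul ?_
  -- The scale of the arc: `2^m ≤ 2π/ℓ < 2^(m+1)`, hence `π < 2^m ℓ ≤ 2π`.
  obtain ⟨m, hm1, hm2⟩ := exists_nat_pow_near (x := 2 * π / ℓ) (y := 2)
    ((one_le_div h0).2 hℓ2) one_lt_two
  have hpi := Real.pi_gt_three
  rw [le_div_iff₀ h0] at hm1
  rw [div_lt_iff₀ h0, pow_succ] at hm2
  have hℓ : ℓ ≤ 2 * π / 2 ^ m := by
    rw [le_div_iff₀ (by positivity)]; linarith
  have hn : 1 ≤ ((2 ^ m : ℕ) : ℝ) * ℓ := by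
    push_cast; linarith
  have h4 : 4 * π / 2 ^ m ≤ 4 * ℓ := by
    rw [div_le_iff₀ (by positivity)]; nlinarith
  have h5 : 2 * (2 ^ m) ^ 2 * ℓ * ℓ ^ 2 ≤ 8 * π ^ 2 * ℓ := by
    have : (2 ^ m * ℓ) ^ 2 ≤ (2 * π) ^ 2 := pow_le_pow_left₀ (by positivity) hm1 2
    nlinarith
  rw [weightMass_carlesonSquare hc hℓ2, areaMeasure, Measure.restrict_smul, lintegral_smul_measure,
    smul_eq_mul]
  set t := tailMass ω (max 0 (1 - ℓ)) with ht
  have h6 := setLIntegral_carlesonSquare_lacunary_le hω hc hb s (hs m) (c := c) h0 hℓ hℓ2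
  rw [← ht] at h6
  have h7 := hK (2 ^ m) ℓ h0 hn
  rw [← ht] at h7
  rw [mul_left_comm]
  refine mul_le_mul_right (h6.trans ?_) _
  rw [← mul_assoc, ← ENNReal.ofReal_mul (by positivity)]
  calc _ ≤ ENNReal.ofReal (8 * π ^ 2 * ℓ) * t + ENNReal.ofReal (4 * ℓ) * (K * t) := by gcongr
    _ = _ := by
      rw [ENNReal.ofReal_mul (p := 8 * π ^ 2) (by positivity),
        ENNReal.ofReal_mul (p := 4) (by norm_num)]
      push_cast
      rw [ENNReal.ofReal_ofNat]
      change _ = (ENNReal.ofReal (8 * π ^ 2) + 4 * (K : ℝ≥0∞)) * _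
      ring

/-! ### Choice of the coefficients. -/

lemma moment_lt_top (hω : IsRadialWeight ω) (hc : ContinuousOn ω (Ico (0 : ℝ) 1)) (n : ℕ) :
    moment ω n < ∞ := (moment_le_tailMass hω n).trans_lt (tailMass_lt_top hω hc le_rfl)

lemma moment_antitone (hω : IsRadialWeight ω) : Antitone (moment ω) := fun m n hmn => by
  refine setLIntegral_mono' measurableSet_Ioo fun s hs => ENNReal.ofReal_le_ofReal ?_
  refine mul_le_mul_of_nonneg_left ?_ (hω.pos s ⟨hs.1.le, hs.2⟩).le
  exact pow_le_pow_of_le_one hs.1.le hs.2.le (by omega)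

lemma aemeasurable_moment (hc : ContinuousOn ω (Ico (0 : ℝ) 1)) (n : ℕ) :
    AEMeasurable (fun s => ENNReal.ofReal (ω s * s ^ n)) (volume.restrict (Ioo (0 : ℝ) 1)) := by
  have hcont : ContinuousOn (fun s => ω s * s ^ n) (Ioo 0 1) :=
    (hc.mono Ioo_subset_Ico_self).mul (continuousOn_id.pow _)
  exact (hcont.aemeasurable measurableSet_Ioo).ennreal_ofReal

lemma moment_pos (hω : IsRadialWeight ω) (hc : ContinuousOn ω (Ico (0 : ℝ) 1)) (n : ℕ) :
    0 < moment ω n := by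
  unfold moment
  rw [pos_iff_ne_zero, Ne, lintegral_eq_zero_iff' (aemeasurable_moment hc _)]
  intro h
  have h1 : ∀ᵐ s ∂volume.restrict (Ioo (0 : ℝ) 1), False := by
    filter_upwards [h, ae_restrict_mem measurableSet_Ioo] with s h2 hs
    exact absurd h2 (by simpa using mul_pos (hω.pos s ⟨hs.1.le, hs.2⟩) (pow_pos hs.1 (n + 1)))
  rw [eventually_false_iff_eq_bot, ae_eq_bot, Measure.restrict_eq_zero] at h1
  simp at h1

lemma tendsto_moment (hω : IsRadialWeight ω) (hc : ContinuousOn ω (Ico (0 : ℝ) 1)) :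
    Tendsto (moment ω) atTop (𝓝 0) := by
  have h := tendsto_lintegral_of_dominated_convergence' (μ := volume.restrict (Ioo (0 : ℝ) 1))
    (F := fun n s => ENNReal.ofReal (ω s * s ^ (n + 1))) (f := fun _ => 0)
    (fun s => ENNReal.ofReal (ω s * s)) (fun n => aemeasurable_moment hc _) ?_
    (tailMass_lt_top hω hc le_rfl).ne ?_
  · rw [lintegral_zero] at h
    exact h
  · intro n
    filter_upwards [ae_restrict_mem measurableSet_Ioo] with s hs
    refine ENNReal.ofReal_le_ofReal ?_
    refine mul_le_mul_of_nonneg_left ?_ (hω.pos s ⟨hs.1.le, hs.2⟩).le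
    exact pow_le_of_le_one hs.1.le hs.2.le (by omega)
  · filter_upwards [ae_restrict_mem measurableSet_Ioo] with s hs
    have h1 : Tendsto (fun n => ω s * s ^ (n + 1)) atTop (𝓝 (ω s * 0)) :=
      ((tendsto_pow_atTop_nhds_zero_of_lt_one hs.1.le hs.2).comp
        (tendsto_add_atTop_nat 1)).const_mul _
    simpa using ENNReal.tendsto_ofReal h1

/-- Over a block on which `G` falls to less than half its initial value, replacing every denominator
by the initial one shows that the block contributes at least `1/2`. There are infinitely many such
blocks. -/
lemma exists_le_sum_relative_decrements {G : ℕ → ℝ} (hpos : ∀ k, 0 < G k) (hanti : Antitone G)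
    (hG : Tendsto G atTop (𝓝 0)) (A : ℝ) :
    ∃ N, A ≤ ∑ k ∈ Finset.Ico 1 N, (G k - G (k + 1)) / G k := by
  have key : ∀ n : ℕ, ∃ N, 1 ≤ N ∧ (n : ℝ) / 2 ≤
      ∑ k ∈ Finset.Ico 1 N, (G k - G (k + 1)) / G k := by
    intro n
    induction n with
    | zero => exact ⟨1, le_rfl, by simp⟩
    | succ n ih =>
      obtain ⟨N, hN1, hN⟩ := ih
      obtain ⟨N', hN', hNN'⟩ : ∃ N', G N' < G N / 2 ∧ N ≤ N' :=
        ((hG.eventually_lt_const (half_pos (hpos N))).and (eventually_ge_atTop N)).exists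
      refine ⟨N', hN1.trans hNN', ?_⟩
      rw [← Finset.sum_Ico_consecutive _ hN1 hNN']
      have h1 : (1 : ℝ) / 2 ≤ ∑ k ∈ Finset.Ico N N', (G k - G (k + 1)) / G k := by
        calc (1 : ℝ) / 2 ≤ (G N - G N') / G N := by
              rw [le_div_iff₀ (hpos N)]; linarith
          _ = ∑ k ∈ Finset.Ico N N', (G k - G (k + 1)) / G N := by
              rw [← Finset.sum_div, ← neg_sub (G N') (G N), ← Finset.sum_Ico_sub G hNN',
                ← Finset.sum_neg_distrib]
              simp only [neg_sub]
          _ ≤ _ := by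
              refine Finset.sum_le_sum fun k hk => ?_
              refine div_le_div_of_nonneg_left ?_ (hpos k) (hanti (Finset.mem_Ico.1 hk).1)
              linarith [hanti (Nat.le_succ k)]
      push_cast
      linarith
  obtain ⟨n, hn⟩ := exists_nat_ge (2 * A)
  obtain ⟨N, -, hN⟩ := key n
  exact ⟨N, by linarith⟩

/-- For every radial weight there are lacunary coefficients dominated by the moments of the weight
whose squares have divergent sum. -/
theorem exists_lacunary_coefficients (hω : IsRadialWeight ω)
    (hc : ContinuousOn ω (Ico (0 : ℝ) 1)) : ∃ b : ℕ → ℝ, (∀ k, |b k| ≤ 1) ∧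
      (∀ N m, ∑ k ∈ Finset.Ico 1 N with m ≤ k, ENNReal.ofReal (b k ^ 2) * moment ω (2 ^ k) ≤
        moment ω (2 ^ m)) ∧
      ∀ A : ℝ, ∃ N, A ≤ ∑ k ∈ Finset.Ico 1 N, b k ^ 2 := by
  set G : ℕ → ℝ := fun k => (moment ω (2 ^ k)).toReal with hG
  have hfin : ∀ n, moment ω n ≠ ∞ := fun n => (moment_lt_top hω hc n).ne
  have hpos : ∀ k, 0 < G k := fun k => ENNReal.toReal_pos (moment_pos hω hc _).ne' (hfin _)
  have hanti : Antitone G := fun j k hjk => ENNReal.toReal_mono (hfin _)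
    (moment_antitone hω (Nat.pow_le_pow_right two_pos hjk))
  have hlim : Tendsto G atTop (𝓝 0) := by
    have := (ENNReal.tendsto_toReal ENNReal.zero_ne_top).comp ((tendsto_moment hω hc).comp
      (tendsto_pow_atTop_atTop_of_one_lt (one_lt_two (α := ℕ))))
    rw [ENNReal.toReal_zero] at this
    exact this
  have hnn : ∀ k, 0 ≤ G k - G (k + 1) := fun k => by linarith [hanti (Nat.le_succ k)]
  have hsq : ∀ k, Real.sqrt ((G k - G (k + 1)) / G k) ^ 2 = (G k - G (k + 1)) / G k := fun k =>
    Real.sq_sqrt (div_nonneg (hnn k) (hpos k).le)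
  -- With this choice `b_k² G_k = G_k - G_{k+1}`, which telescopes.
  refine ⟨fun k => Real.sqrt ((G k - G (k + 1)) / G k), fun k => ?_, fun N m => ?_, fun A => ?_⟩
  · rw [abs_of_nonneg (Real.sqrt_nonneg _)]
    refine Real.sqrt_le_one.2 ?_
    rw [div_le_one (hpos k)]
    linarith [hpos (k + 1)]
  · have h1 : ∀ k, ENNReal.ofReal (Real.sqrt ((G k - G (k + 1)) / G k) ^ 2) * moment ω (2 ^ k) =
        ENNReal.ofReal (G k - G (k + 1)) := by
      intro k
      rw [hsq, ← ENNReal.ofReal_toReal (hfin (2 ^ k)),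
        ← ENNReal.ofReal_mul (div_nonneg (hnn k) (hpos k).le)]
      congr 1
      exact div_mul_cancel₀ _ (hpos k).ne'
    simp only [h1]
    rw [← ENNReal.ofReal_sum_of_nonneg fun k _ => hnn k, ← ENNReal.ofReal_toReal (hfin (2 ^ m))]
    refine ENNReal.ofReal_le_ofReal ?_
    calc ∑ k ∈ Finset.Ico 1 N with m ≤ k, (G k - G (k + 1))
        ≤ ∑ k ∈ Finset.Ico m (max m N), (G k - G (k + 1)) := by
          refine Finset.sum_le_sum_of_subset_of_nonneg (fun k hk => ?_) fun k _ _ => hnn k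
          simp only [Finset.mem_filter, Finset.mem_Ico, lt_max_iff] at hk ⊢
          omega
      _ = G m - G (max m N) := by
          rw [← neg_sub (G (max m N)), ← Finset.sum_Ico_sub G (le_max_left m N),
            ← Finset.sum_neg_distrib]
          simp only [neg_sub]
      _ ≤ G m := by linarith [hpos (max m N)]
  · simp only [hsq]
    exact exists_le_sum_relative_decrements hpos hanti hlim A

/-! ### Lower bound for the Dirichlet-type integral on a half disc. -/

/-- The half disc `{Re w > 0, |w| < R}`. -/
def rightHalfDisc (R : ℝ) : Set ℂ := {w | 0 < w.re ∧ ‖w‖ < R}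

lemma isOpen_rightHalfDisc (R : ℝ) : IsOpen (rightHalfDisc R) :=
  (isOpen_lt continuous_const Complex.continuous_re).inter
    (isOpen_lt continuous_norm continuous_const)

/-- The angular interval of length `π` is written as `2π/2^1` so that local Parseval applies with `m
= 1`; hence the requirement `k ≥ 1` on frequencies. -/
lemma le_setLIntegral_rightHalfDisc (f : ℂ → ℝ≥0∞) (hf : Measurable f) (R : ℝ) :
    ∫⁻ r in Ioo 0 R, ∫⁻ θ in Ioo (-(π / 2)) (-(π / 2) + 2 * π / 2 ^ 1),
        ENNReal.ofReal r * f (polarPt r θ) ≤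
      ∫⁻ z in rightHalfDisc R, f z := by
  have hm := (isOpen_rightHalfDisc R).measurableSet
  rw [← lintegral_indicator hm, lintegral_polar _ (hf.indicator hm) (-π)]
  refine le_trans ?_ (lintegral_mono_set (fun x hx => hx.1 : Ioo 0 R ⊆ Ioi 0))
  refine setLIntegral_mono' measurableSet_Ioo fun r hr => ?_
  have hpi := Real.pi_pos
  refine le_trans ?_ (lintegral_mono_set
    (fun x hx => ⟨by linarith [hx.1], by linarith [hx.2]⟩ :
      Ioo (-(π / 2)) (-(π / 2) + 2 * π / 2 ^ 1) ⊆ Ioc (-π) (-π + 2 * π)))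
  refine setLIntegral_mono' measurableSet_Ioo fun θ hθ => ?_
  rw [indicator_of_mem]
  refine ⟨?_, by simpa [abs_of_pos hr.1] using hr.2⟩
  have h1 : (polarPt r θ).re = r * Real.cos θ := by
    rw [polarPt, Complex.re_ofReal_mul, Complex.exp_ofReal_mul_I_re]
  rw [h1]
  exact mul_pos hr.1 (Real.cos_pos_of_mem_Ioo ⟨hθ.1, by linarith [hθ.2]⟩)

/-- Only the shell `1 - 2^(-k) < r < 1 - 2^(-k-1)` is kept. There Bernoulli's inequality bounds the
powers of `r` below, `1 - r` is of order `2^(-k)`, and the cutoff at `N + 1` leaves the shell inside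
the domain for all `k ≤ N`. -/
lemma le_lintegral_radial {k N : ℕ} (hk : 1 ≤ k) (hkN : k ≤ N) :
    ENNReal.ofReal (1 / 64) ≤ ∫⁻ r in Ioo (0 : ℝ) (1 - 1 / 2 ^ (N + 1)),
      ENNReal.ofReal (r * (1 - r) * (2 ^ k * r ^ (2 ^ k - 1)) ^ 2) := by
  obtain ⟨j, rfl⟩ := Nat.exists_eq_add_of_le' hk
  set h : ℝ := 2 ^ j with hh
  have hh1 : 1 ≤ h := one_le_pow₀ one_le_two
  have hpow : (2 : ℝ) ^ (j + 1) = 2 * h := by rw [pow_succ]; ring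
  have hR : 4 * h ≤ 2 ^ (N + 1) := by
    calc 4 * h = 2 ^ (j + 2) := by rw [pow_add, hh]; ring
      _ ≤ 2 ^ (N + 1) := pow_le_pow_right₀ one_le_two (by omega)
  have hsub : Ioo (1 - 1 / (2 * h)) (1 - 1 / (4 * h)) ⊆ Ioo (0 : ℝ) (1 - 1 / 2 ^ (N + 1)) := by
    intro r hr
    have h1 : 1 / (2 * h) ≤ 1 := by rw [div_le_one (by positivity)]; linarith
    have h2 : 1 / 2 ^ (N + 1) ≤ 1 / (4 * h) := one_div_le_one_div_of_le (by positivity) hR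
    exact ⟨by linarith [hr.1], by linarith [hr.2]⟩
  refine le_trans ?_ (lintegral_mono_set hsub)
  calc ENNReal.ofReal (1 / 64) = ∫⁻ r in Ioo (1 - 1 / (2 * h)) (1 - 1 / (4 * h)),
        ENNReal.ofReal (h / 16) := by
        simp only [lintegral_const, Measure.restrict_apply_univ, Real.volume_Ioo]
        rw [← ENNReal.ofReal_mul (by positivity)]
        congr 1
        field_simp
        ring
    _ ≤ _ := by
        refine setLIntegral_mono' measurableSet_Ioo fun r hr => ENNReal.ofReal_le_ofReal ?_
        have hr0 := (hsub hr).1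
        have hr1 : 1 / (4 * h) ≤ 1 - r := by linarith [hr.2]
        have hr2 : 0 ≤ 1 - r := le_trans (by positivity) hr1
        have h1 : 1 / 2 ≤ r ^ (2 ^ j) := by
          have hb := one_add_mul_le_pow (a := -(1 / (2 * h)))
            (by have : 1 / (2 * h) ≤ 1 := by { rw [div_le_one (by positivity)]; linarith }
                linarith) (2 ^ j)
          have h2 : 1 + ((2 ^ j : ℕ) : ℝ) * -(1 / (2 * h)) = 1 / 2 := by
            push_cast
            rw [← hh]; field_simp; ring
          rw [h2] at hb
          refine hb.trans (pow_le_pow_left₀ ?_ (by linarith [hr.1]) _)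
          have : 1 / (2 * h) ≤ 1 := by rw [div_le_one (by positivity)]; linarith
          linarith
        -- With `p = 2^j` the total exponent of `r` is `4p - 1`, so the product is at least
        -- `(r^p)^4`.
        have h3 : 1 / 16 ≤ r * (r ^ (2 ^ (j + 1) - 1)) ^ 2 := by
          calc (1 : ℝ) / 16 = (1 / 2) ^ 4 := by norm_num
            _ ≤ (r ^ (2 ^ j)) ^ 4 := pow_le_pow_left₀ (by norm_num) h1 4
            _ = r ^ (2 ^ j * 4) := (pow_mul _ _ _).symm
            _ ≤ r ^ (1 + (2 ^ (j + 1) - 1) * 2) := by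
                refine pow_le_pow_of_le_one hr0.le (by linarith) ?_
                rw [pow_succ]
                have := Nat.one_le_two_pow (n := j)
                generalize 2 ^ j = p at this ⊢
                omega
            _ = _ := by rw [pow_add, pow_mul, pow_one]
        calc h / 16 = 1 / (4 * h) * (2 * h) ^ 2 * (1 / 16) := by field_simp; ring
          _ ≤ (1 - r) * (2 * h) ^ 2 * (r * (r ^ (2 ^ (j + 1) - 1)) ^ 2) := by gcongr
          _ = _ := by rw [hpow]; ring

/-- The Dirichlet-type integral of a lacunary polynomial over a half disc dominates the square sum
of its coefficients. -/
lemma le_setLIntegral_rightHalfDisc_lacunary (b : ℕ → ℝ) {s : Finset ℕ} {N : ℕ}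
    (hs : ∀ k ∈ s, 1 ≤ k ∧ k ≤ N) :
    ENNReal.ofReal (π / 64 * ∑ k ∈ s, b k ^ 2) ≤
      ∫⁻ w in rightHalfDisc (1 - 1 / 2 ^ (N + 1)),
        ENNReal.ofReal (‖lacunaryDeriv b s w‖ ^ 2) * ENNReal.ofReal (1 - ‖w‖) := by
  set R : ℝ := 1 - 1 / 2 ^ (N + 1) with hR
  have hR1 : R ≤ 1 := by
    have : (0 : ℝ) ≤ 1 / 2 ^ (N + 1) := by positivity
    linarith
  refine le_trans ?_ (le_setLIntegral_rightHalfDisc _ ?_ R)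
  swap
  · refine Measurable.mul (Measurable.ennreal_ofReal (Continuous.measurable ?_))
      (Measurable.ennreal_ofReal (Continuous.measurable ?_)) <;> fun_prop
  calc ENNReal.ofReal (π / 64 * ∑ k ∈ s, b k ^ 2)
      = ∑ k ∈ s, ENNReal.ofReal (π * b k ^ 2) * ENNReal.ofReal (1 / 64) := by
        rw [Finset.mul_sum, ENNReal.ofReal_sum_of_nonneg fun k _ => by positivity]
        refine Finset.sum_congr rfl fun k _ => ?_
        rw [← ENNReal.ofReal_mul (by positivity)]
        congr 1; ring
    _ ≤ ∑ k ∈ s, ENNReal.ofReal (π * b k ^ 2) * ∫⁻ r in Ioo (0 : ℝ) R,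
          ENNReal.ofReal (r * (1 - r) * (2 ^ k * r ^ (2 ^ k - 1)) ^ 2) := by
        gcongr with k hk
        exact le_lintegral_radial (hs k hk).1 (hs k hk).2
    _ = ∫⁻ r in Ioo (0 : ℝ) R, ∑ k ∈ s, ENNReal.ofReal (π * b k ^ 2) *
          ENNReal.ofReal (r * (1 - r) * (2 ^ k * r ^ (2 ^ k - 1)) ^ 2) := by
        rw [lintegral_finsetSum]
        · refine Finset.sum_congr rfl fun k _ => ?_
          rw [lintegral_const_mul' _ _ ENNReal.ofReal_ne_top]
        · intro k _
          fun_prop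
    _ ≤ _ := by
        refine setLIntegral_mono' measurableSet_Ioo fun r hr => ?_
        have h1 : 0 ≤ 1 - r := by linarith [hr.2]
        have h2 : 0 ≤ r * (1 - r) := mul_nonneg hr.1.le h1
        simp only [norm_polarPt, abs_of_pos hr.1]
        rw [lintegral_const_mul _ (by fun_prop), lintegral_mul_const _ (by fun_prop),
          lintegral_norm_sq_lacunaryDeriv b (fun k hk => (hs k hk).1),
          ← ENNReal.ofReal_mul (by positivity), ← ENNReal.ofReal_mul hr.1.le, Finset.mul_sum,
          Finset.sum_mul, Finset.mul_sum, ENNReal.ofReal_sum_of_nonneg]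
        · refine Finset.sum_le_sum fun k _ => ?_
          rw [← ENNReal.ofReal_mul (by positivity)]
          refine ENNReal.ofReal_le_ofReal (le_of_eq ?_)
          ring
        · intro k _
          have := hr.1
          positivity

/-! ### Disc automorphisms concentrating the half disc near the point 1. -/

/-- The automorphism `z ↦ (z - a) / (1 - a z)` of the disc. -/
noncomputable def discAut (a : ℝ) (z : ℂ) : ℂ := (z - a) / (1 - a * z)

section DiscAut

variable {a : ℝ}

lemma one_sub_mul_ne_zero (ha : |a| < 1) {z : ℂ} (hz : ‖z‖ < 1) : 1 - (a : ℂ) * z ≠ 0 := by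
  intro h
  have h1 : (a : ℂ) * z = 1 := (sub_eq_zero.1 h).symm
  have h2 : |a| * ‖z‖ = 1 := by
    have := congrArg norm h1
    simpa using this
  nlinarith [norm_nonneg z, abs_nonneg a]

lemma normSq_one_sub_mul_sub (a : ℝ) (z : ℂ) :
    ‖1 - (a : ℂ) * z‖ ^ 2 - ‖z - a‖ ^ 2 = (1 - a ^ 2) * (1 - ‖z‖ ^ 2) := by
  simp only [Complex.sq_norm, Complex.normSq_apply, Complex.sub_re, Complex.sub_im, Complex.one_re,
    Complex.one_im, Complex.mul_re, Complex.mul_im, Complex.ofReal_re, Complex.ofReal_im]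
  ring

lemma one_sub_norm_discAut_sq (ha : |a| < 1) {z : ℂ} (hz : ‖z‖ < 1) :
    1 - ‖discAut a z‖ ^ 2 = (1 - a ^ 2) * (1 - ‖z‖ ^ 2) / ‖1 - (a : ℂ) * z‖ ^ 2 := by
  have h := norm_ne_zero_iff.2 (one_sub_mul_ne_zero ha hz)
  rw [← normSq_one_sub_mul_sub, discAut, norm_div, div_pow, sub_div, div_self (pow_ne_zero 2 h)]

lemma norm_discAut_lt_one (ha : |a| < 1) {z : ℂ} (hz : ‖z‖ < 1) : ‖discAut a z‖ < 1 := by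
  have h1 := one_sub_norm_discAut_sq ha hz
  have h2 : 0 < ‖1 - (a : ℂ) * z‖ := norm_pos_iff.2 (one_sub_mul_ne_zero ha hz)
  have h3 : 0 < 1 - a ^ 2 := by rw [sub_pos, sq_lt_one_iff_abs_lt_one]; exact ha
  have h4 : 0 < 1 - ‖z‖ ^ 2 := by nlinarith [norm_nonneg z]
  have h5 : 0 < 1 - ‖discAut a z‖ ^ 2 := by rw [h1]; positivity
  nlinarith [norm_nonneg (discAut a z)]

lemma discAut_discAut_neg (ha : |a| < 1) {w : ℂ} (hw : ‖w‖ < 1) :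
    discAut a (discAut (-a) w) = w := by
  have ha' : |(-a)| < 1 := by rwa [abs_neg]
  have h1 := one_sub_mul_ne_zero ha' hw
  have h2 := one_sub_mul_ne_zero ha (norm_discAut_lt_one ha' hw)
  have h3 : discAut (-a) w * (1 - ((-a : ℝ) : ℂ) * w) = w - ((-a : ℝ) : ℂ) := div_mul_cancel₀ _ h1
  rw [discAut, div_eq_iff h2]
  push_cast at h3
  linear_combination h3

lemma isDiscMobius_discAut (ha : |a| < 1) : IsDiscMobius (discAut a) := by
  have ha' : |(-a)| < 1 := by rwa [abs_neg]
  refine ⟨⟨1, -a, -a, 1, ?_, fun z hz => ⟨?_, ?_⟩⟩, ?_⟩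
  · have h3 : 0 < 1 - a ^ 2 := by rw [sub_pos, sq_lt_one_iff_abs_lt_one]; exact ha
    have h4 : ((1 - a ^ 2 : ℝ) : ℂ) ≠ 0 := by exact_mod_cast h3.ne'
    convert h4 using 1
    push_cast; ring
  · have := one_sub_mul_ne_zero ha (z := z) (by simpa [unitDisc] using hz)
    convert this using 1
    ring
  · rw [discAut]
    congr 1 <;> ring
  · ext w
    simp only [unitDisc, mem_image, mem_ball_zero_iff]
    constructor
    · rintro ⟨z, hz, rfl⟩
      exact norm_discAut_lt_one ha hz
    · intro hw
      exact ⟨discAut (-a) w, norm_discAut_lt_one ha' hw, discAut_discAut_neg ha hw⟩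

lemma differentiableAt_discAut (ha : |a| < 1) {z : ℂ} (hz : ‖z‖ < 1) :
    DifferentiableAt ℂ (discAut a) z := by
  unfold discAut
  exact DifferentiableAt.div (by fun_prop) (by fun_prop) (one_sub_mul_ne_zero ha hz)

/-- Differentiating `g ∘ discAut a ∘ discAut (-a) = g` avoids computing the derivative of the
automorphism. -/
lemma deriv_comp_discAut_mul (ha : |a| < 1) {g : ℂ → ℂ} (hg : Differentiable ℂ g) {w : ℂ}
    (hw : ‖w‖ < 1) :
    deriv (g ∘ discAut a) (discAut (-a) w) * deriv (discAut (-a)) w = deriv g w := by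
  have ha' : |(-a)| < 1 := by rwa [abs_neg]
  have h1 : DifferentiableAt ℂ (g ∘ discAut a) (discAut (-a) w) :=
    (hg _).comp _ (differentiableAt_discAut ha (norm_discAut_lt_one ha' hw))
  have h2 := differentiableAt_discAut ha' hw
  rw [← deriv_comp w h1 h2]
  refine Filter.EventuallyEq.deriv_eq ?_
  have h3 : Metric.ball (0 : ℂ) 1 ∈ 𝓝 w := Metric.isOpen_ball.mem_nhds (by simpa using hw)
  filter_upwards [h3] with v hv
  simp only [Function.comp_apply]
  rw [discAut_discAut_neg ha (by simpa using hv)]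

lemma one_le_norm_one_add_mul (ha : 0 ≤ a) {w : ℂ} (hw : 0 ≤ w.re) :
    1 ≤ ‖1 - ((-a : ℝ) : ℂ) * w‖ := by
  refine le_trans ?_ (Complex.re_le_norm _)
  simp
  positivity

/-- The distance to 1 equals `(1 - a)‖w - 1‖ / ‖1 + a w‖`, and the denominator is at least 1 on the
right half plane: this is why a half disc is used. -/
lemma norm_discAut_neg_sub_one_le (ha : 0 ≤ a) (ha1 : a < 1) {w : ℂ} (hw : 0 ≤ w.re)
    (hw1 : ‖w‖ < 1) : ‖discAut (-a) w - 1‖ ≤ 2 * (1 - a) := by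
  have ha' : |(-a)| < 1 := by rwa [abs_neg, abs_of_nonneg ha]
  have h1 := one_sub_mul_ne_zero ha' hw1
  have h2 : discAut (-a) w - 1 = ((1 - a : ℝ) : ℂ) * (w - 1) / (1 - ((-a : ℝ) : ℂ) * w) := by
    rw [discAut, eq_div_iff h1, sub_mul, div_mul_cancel₀ _ h1]
    push_cast; ring
  rw [h2, norm_div, norm_mul, Complex.norm_real, Real.norm_eq_abs, abs_of_nonneg (by linarith)]
  have h3 := one_le_norm_one_add_mul ha hw
  have h4 : ‖w - 1‖ ≤ 2 := by
    refine (norm_sub_le _ _).trans ?_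
    rw [norm_one]; linarith
  rw [div_le_iff₀ (by linarith)]
  have h5 : 0 ≤ 1 - a := by linarith
  calc (1 - a) * ‖w - 1‖ ≤ (1 - a) * 2 := by gcongr
    _ = 2 * (1 - a) * 1 := by ring
    _ ≤ _ := by gcongr

lemma le_one_sub_norm_discAut_neg (ha : 0 ≤ a) (ha1 : a < 1) {w : ℂ} (hw1 : ‖w‖ < 1) :
    (1 - a) * (1 - ‖w‖) / 8 ≤ 1 - ‖discAut (-a) w‖ := by
  have ha' : |(-a)| < 1 := by rwa [abs_neg, abs_of_nonneg ha]
  have h0 : 0 < ‖1 - ((-a : ℝ) : ℂ) * w‖ := norm_pos_iff.2 (one_sub_mul_ne_zero ha' hw1)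
  have h1 := one_sub_norm_discAut_sq ha' hw1
  have h2 : ‖1 - ((-a : ℝ) : ℂ) * w‖ ≤ 2 := by
    refine (norm_sub_le _ _).trans ?_
    rw [norm_one, norm_mul, Complex.norm_real, Real.norm_eq_abs]
    nlinarith [norm_nonneg w, abs_nonneg (-a)]
  have h3 : ‖1 - ((-a : ℝ) : ℂ) * w‖ ^ 2 ≤ 4 := by nlinarith
  have h4 : (1 - a) * (1 - ‖w‖) ≤ (1 - (-a) ^ 2) * (1 - ‖w‖ ^ 2) := by
    have := norm_nonneg w
    refine mul_le_mul (by nlinarith) (by nlinarith) (by linarith) (by nlinarith)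
  have h5 : (1 - a) * (1 - ‖w‖) / 4 ≤ 1 - ‖discAut (-a) w‖ ^ 2 := by
    rw [h1]
    refine div_le_div₀ (le_trans ?_ h4) h4 (by positivity) h3
    exact mul_nonneg (by linarith) (by linarith)
  have h6 := norm_discAut_lt_one ha' hw1
  nlinarith [norm_nonneg (discAut (-a) w)]

end DiscAut

/-! ### Change of variables and the lower bound after composition. -/

/-- Here `‖z‖ ≥ 1/2`, so `|sin (arg z)| ≤ 4ε`; Jordan's inequality and `π ≤ 4` then give `|arg z| ≤
8ε`. -/
lemma mem_carlesonSquare_of_norm_sub_one_le {z : ℂ} {ε : ℝ} (hε : ε ≤ 1 / 8) (hz : ‖z‖ < 1)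
    (h : ‖z - 1‖ ≤ 2 * ε) : z ∈ carlesonSquare (-(8 * ε)) (16 * ε) := by
  have hε0 : 0 ≤ ε := by linarith [norm_nonneg (z - 1)]
  have hre : 1 - 2 * ε ≤ z.re := by
    have := (abs_le.1 ((Complex.abs_re_le_norm (z - 1)).trans h)).1
    simp at this; linarith
  have him : |z.im| ≤ 2 * ε := by
    have := (Complex.abs_im_le_norm (z - 1)).trans h
    simpa using this
  have hnorm : 1 - 2 * ε ≤ ‖z‖ := hre.trans (Complex.re_le_norm z)
  have hz0 : z ≠ 0 := norm_pos_iff.1 (by linarith)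
  have harg : |Complex.arg z| ≤ π / 2 := Complex.abs_arg_le_pi_div_two_iff.2 (by linarith)
  have hsin : |Real.sin (Complex.arg z)| ≤ 4 * ε := by
    rw [Complex.sin_arg, abs_div, abs_of_nonneg (norm_nonneg z), div_le_iff₀ (by linarith)]
    nlinarith
  have h1 : 2 / π * |Complex.arg z| ≤ 4 * ε := by
    refine le_trans (Real.mul_abs_le_abs_sin harg) hsin
  have h2 : |Complex.arg z| ≤ 8 * ε := by
    rw [div_mul_eq_mul_div, div_le_iff₀ Real.pi_pos] at h1
    nlinarith [Real.pi_le_four]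
  rw [abs_le] at h2
  refine ⟨‖z‖, Complex.arg z, norm_nonneg z, by linarith, hz, ⟨h2.1, by linarith [h2.2]⟩, ?_⟩
  exact (Complex.norm_mul_exp_arg_mul_I z).symm

lemma det_smul_one_complex (c : ℂ) : (c • (1 : ℂ →L[ℝ] ℂ)).det = ‖c‖ ^ 2 := by
  rw [Complex.sq_norm, ← Algebra.norm_complex_apply, Algebra.norm_apply]
  rfl

/-- Change of variables for an injective holomorphic map. -/
lemma lintegral_image_holomorphic {s : Set ℂ} (hs : MeasurableSet s) {f : ℂ → ℂ}
    (hf : ∀ z ∈ s, DifferentiableAt ℂ f z) (hinj : InjOn f s) (h : ℂ → ℝ≥0∞) :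
    ∫⁻ z in f '' s, h z = ∫⁻ z in s, ENNReal.ofReal (‖deriv f z‖ ^ 2) * h (f z) := by
  rw [lintegral_image_eq_lintegral_abs_det_fderiv_mul volume hs
    (fun z hz => (hf z hz).hasDerivAt.complexToReal_fderiv.hasFDerivWithinAt) hinj]
  refine lintegral_congr fun z => ?_
  rw [det_smul_one_complex, abs_of_nonneg (by positivity)]

/-- For a doubling weight, composing a lacunary polynomial with a suitable disc automorphism makes
its Carleson seminorm comparable to the Hardy space norm. -/
theorem exists_le_carlesonSup_lacunary_comp (hω : IsRadialWeight ω)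
    (hc : ContinuousOn ω (Ico (0 : ℝ) 1)) {C : ℝ} (hC : 0 < C)
    (hd : ∀ r : ℝ, 0 ≤ r → r < 1 →
      (∫ s in r..1, ω s * s) ≤ C * ∫ s in (2 * r / (1 + r ^ 2))..1, ω s * s)
    (b : ℕ → ℝ) {s : Finset ℕ} {N : ℕ} (hs : ∀ k ∈ s, 1 ≤ k ∧ k ≤ N) :
    ∃ φ, IsDiscMobius φ ∧ ENNReal.ofReal (1 / (256 * C) * (π / 64 * ∑ k ∈ s, b k ^ 2)) ≤
      carlesonSup ω (lacunary b s ∘ φ) := by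
  set δ : ℝ := 1 / 2 ^ (N + 1) with hδ
  have hδ0 : 0 < δ := by positivity
  have hδ1 : δ ≤ 1 := by
    rw [hδ, div_le_one (by positivity)]; exact one_le_pow₀ one_le_two
  -- The constant is fixed by the later use of doubling, which needs `(16ε)² ≤ εδ/16`, that is `δ ≥
  -- 4096 ε`.
  obtain ⟨ε, hε⟩ : ∃ ε : ℝ, ε = δ / 4096 := ⟨_, rfl⟩
  have hε0 : 0 < ε := by rw [hε]; positivity
  have hε1 : ε ≤ 1 / 4096 := by rw [hε]; linarith
  obtain ⟨a, ha⟩ : ∃ a : ℝ, a = 1 - ε := ⟨_, rfl⟩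
  have ha0 : 0 ≤ a := by linarith
  have ha1 : a < 1 := by linarith
  have haa : |a| < 1 := by rwa [abs_of_nonneg ha0]
  have haa' : |(-a)| < 1 := by rwa [abs_neg]
  have hea : 1 - a = ε := by linarith
  refine ⟨discAut a, isDiscMobius_discAut haa, ?_⟩
  set W := rightHalfDisc (1 - δ) with hW
  set S := carlesonSquare (-(8 * ε)) (16 * ε) with hS
  have hW1 : ∀ w ∈ W, ‖w‖ < 1 := fun w hw => hw.2.trans (by linarith)
  have hWS : discAut (-a) '' W ⊆ S := by
    rintro _ ⟨w, hw, rfl⟩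
    refine mem_carlesonSquare_of_norm_sub_one_le (by linarith)
      (norm_discAut_lt_one haa' (hW1 w hw)) ?_
    rw [← hea]
    exact norm_discAut_neg_sub_one_le ha0 ha1 hw.1.le (hW1 w hw)
  have hinj : InjOn (discAut (-a)) W := by
    intro w hw v hv h
    rw [← discAut_discAut_neg haa (hW1 w hw), h, discAut_discAut_neg haa (hW1 v hv)]
  set t := tailMass ω (1 - 16 * ε) with ht
  have ht0 : 0 < t := tailMass_pos hω hc (by linarith) (by linarith)
  have htop : t < ∞ := tailMass_lt_top hω hc (by linarith)
  set I := ∫⁻ w in W, ENNReal.ofReal (‖lacunaryDeriv b s w‖ ^ 2) * ENNReal.ofReal (1 - ‖w‖) with hI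
  have hnum : ENNReal.ofReal (ε / (16 * C)) * t * I ≤ ∫⁻ z in S,
      ENNReal.ofReal (‖deriv (lacunary b s ∘ discAut a) z‖ ^ 2 * associatedWeight ω z) := by
    refine le_trans ?_ (lintegral_mono_set hWS)
    rw [lintegral_image_holomorphic (isOpen_rightHalfDisc _).measurableSet
      (fun w hw => differentiableAt_discAut haa' (hW1 w hw)) hinj, hI,
      ← lintegral_const_mul' _ _ (ENNReal.mul_ne_top ENNReal.ofReal_ne_top htop.ne)]
    refine setLIntegral_mono' (isOpen_rightHalfDisc _).measurableSet fun w hw => ?_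
    have hw1 := hW1 w hw
    set z := discAut (-a) w with hz
    have hz1 : ‖z‖ < 1 := norm_discAut_lt_one haa' hw1
    have hzlow : 1 - 2 * ε ≤ ‖z‖ := by
      have h1 := norm_discAut_neg_sub_one_le ha0 ha1 hw.1.le hw1
      have h2 := norm_sub_norm_le (1 : ℂ) (1 - z)
      rw [sub_sub_cancel, norm_one, norm_sub_rev] at h2
      rw [← hz, hea] at h1
      linarith
    have hzup : ε * (1 - ‖w‖) / 8 ≤ 1 - ‖z‖ := by
      rw [← hea]
      exact le_one_sub_norm_discAut_neg ha0 ha1 hw1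
    have hwδ : δ ≤ 1 - ‖w‖ := by linarith [hw.2]
    -- The base point lies at distance `16ε` from 1, and the midpoint of `‖z‖` and 1 at distance at
    -- least `εδ/16 = 256 ε² = (16ε)²`.
    have hdoub : t ≤ ENNReal.ofReal C * tailMass ω ((1 + ‖z‖) / 2) := by
      refine tailMass_le_of_doubling hω hc hC hd (by linarith) (by linarith) ?_
      have h1 : δ = 4096 * ε := by rw [hε]; ring
      nlinarith
    have hdoub' : ENNReal.ofReal (1 / C) * t ≤ tailMass ω ((1 + ‖z‖) / 2) := by
      calc _ ≤ ENNReal.ofReal (1 / C) * (ENNReal.ofReal C * tailMass ω ((1 + ‖z‖) / 2)) := by gcongr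
        _ = _ := by
          rw [← mul_assoc, ← ENNReal.ofReal_mul (by positivity), one_div_mul_cancel hC.ne',
            ENNReal.ofReal_one, one_mul]
    have hassoc : ENNReal.ofReal (ε / (16 * C) * (1 - ‖w‖)) * t ≤
        ENNReal.ofReal (associatedWeight ω z) := by
      refine le_trans ?_ (le_ofReal_associatedWeight hω hc (by linarith) hz1)
      calc _ = ENNReal.ofReal (ε * (1 - ‖w‖) / 8 / 2) * (ENNReal.ofReal (1 / C) * t) := by
            rw [← mul_assoc, ← ENNReal.ofReal_mul (by have : 0 ≤ 1 - ‖w‖ := by linarith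
                                                      positivity)]
            congr 2
            field_simp
            ring
        _ ≤ _ := by gcongr
    have hder := deriv_comp_discAut_mul haa (g := lacunary b s)
      (fun v => (hasDerivAt_lacunary b s v).differentiableAt) hw1
    -- The Jacobian `|(discAut (-a))'|²` is exactly what turns `|(g ∘ φ)'(z)|²` into `|g'(w)|²`.
    rw [(hasDerivAt_lacunary b s w).deriv, ← hz] at hder
    rw [← hder, norm_mul, mul_pow, ENNReal.ofReal_mul (p := ‖_‖ ^ 2) (by positivity),
      ENNReal.ofReal_mul (p := ‖_‖ ^ 2) (by positivity)]
    rw [ENNReal.ofReal_mul (by positivity)] at hassoc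
    calc _ = ENNReal.ofReal (‖deriv (discAut (-a)) w‖ ^ 2) *
          (ENNReal.ofReal (‖deriv (lacunary b s ∘ discAut a) z‖ ^ 2) *
            (ENNReal.ofReal (ε / (16 * C)) * ENNReal.ofReal (1 - ‖w‖) * t)) := by ring
      _ ≤ _ := by gcongr
  have hIlow : ENNReal.ofReal (π / 64 * ∑ k ∈ s, b k ^ 2) ≤ I :=
    le_setLIntegral_rightHalfDisc_lacunary b hs
  have hpi := Real.pi_gt_three
  have hsup : (∫⁻ z in S, ENNReal.ofReal (‖deriv (lacunary b s ∘ discAut a) z‖ ^ 2 *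
      associatedWeight ω z) ∂areaMeasure) / weightMass ω S ≤
      carlesonSup ω (lacunary b s ∘ discAut a) :=
    le_iSup_of_le (-(8 * ε)) (le_iSup_of_le (16 * ε)
      (le_iSup_of_le ⟨by linarith, by linarith⟩ le_rfl))
  refine le_trans ?_ hsup
  have hmax : max 0 (1 - 16 * ε) = 1 - 16 * ε := max_eq_right (by linarith)
  rw [weightMass_carlesonSquare hc (by linarith), hmax, ← ht, areaMeasure, Measure.restrict_smul,
    lintegral_smul_measure, smul_eq_mul]
  have hπ0 : ENNReal.ofReal (1 / π) ≠ 0 := by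
    simpa using Real.pi_pos
  have hε' : ENNReal.ofReal (16 * ε) ≠ 0 := by
    simpa using hε0
  rw [ENNReal.le_div_iff_mul_le
    (Or.inl (mul_ne_zero hπ0 (mul_ne_zero hε' ht0.ne')))
    (Or.inl (ENNReal.mul_ne_top ENNReal.ofReal_ne_top
      (ENNReal.mul_ne_top ENNReal.ofReal_ne_top htop.ne)))]
  rw [mul_left_comm]
  refine mul_le_mul_right (le_trans ?_ hnum) _
  calc _ = ENNReal.ofReal (ε / (16 * C)) * t * ENNReal.ofReal (π / 64 * ∑ k ∈ s, b k ^ 2) := by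
        rw [ENNReal.ofReal_mul (p := 1 / (256 * C)) (by positivity)]
        have : ENNReal.ofReal (ε / (16 * C)) =
            ENNReal.ofReal (1 / (256 * C)) * ENNReal.ofReal (16 * ε) := by
          rw [← ENNReal.ofReal_mul (by positivity)]
          congr 1
          field_simp
          ring
        rw [this]
        ring
    _ ≤ _ := by gcongr

/-! ### Failure of conformal invariance. -/

/-- Bounded test functions whose Möbius compositions have unbounded seminorm. -/
theorem exists_carlesonSup_comp_unbounded (hω : IsRadialWeight ω)
    (hc : ContinuousOn ω (Ico (0 : ℝ) 1)) (hinc : EssentiallyIncreasing ω)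
    (hdoubling : ∃ C : ℝ, 0 < C ∧ ∀ r : ℝ, 0 ≤ r → r < 1 →
      (∫ s in r..1, ω s * s) ≤ C * ∫ s in (2 * r / (1 + r ^ 2))..1, ω s * s) :
    ∃ M : ℝ≥0, ∀ A : ℝ≥0, ∃ g : ℂ → ℂ, Differentiable ℂ g ∧ g 0 = 0 ∧ carlesonSup ω g ≤ M ∧
      ∃ φ, IsDiscMobius φ ∧ A ≤ carlesonSup ω (g ∘ φ) := by
  obtain ⟨C, hC, hd⟩ := hdoubling
  obtain ⟨M, hM⟩ := exists_carlesonSup_lacunary_le hω hc hinc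
  obtain ⟨b, hb1, hb2, hb3⟩ := exists_lacunary_coefficients hω hc
  refine ⟨M, fun A => ?_⟩
  obtain ⟨N, hN⟩ := hb3 (A * (256 * C) * (64 / π))
  obtain ⟨φ, hφ, hle⟩ := exists_le_carlesonSup_lacunary_comp hω hc hC hd b
    (s := Finset.Ico 1 N) (N := N) fun k hk =>
      ⟨(Finset.mem_Ico.1 hk).1, (Finset.mem_Ico.1 hk).2.le⟩
  refine ⟨lacunary b (Finset.Ico 1 N), fun z => (hasDerivAt_lacunary b _ z).differentiableAt, ?_,
    hM b _ hb1 (hb2 N), φ, hφ, le_trans ?_ hle⟩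
  · simp [lacunary]
  · rw [← ENNReal.ofReal_coe_nnreal]
    refine ENNReal.ofReal_le_ofReal ?_
    have hpi := Real.pi_pos
    calc (A : ℝ) = 1 / (256 * C) * (π / 64 * (A * (256 * C) * (64 / π))) := by field_simp
      _ ≤ _ := by gcongr

/-- Covers seminorm and norm at once: the test functions vanish at 0, where the two agree, and for
the compositions only domination of the seminorm is needed. -/
lemma not_isConformallyInvariant_of_seminorm_le {ρ : (ℂ → ℂ) → ℝ≥0∞}
    (hle : ∀ g, carlesonSup ω g ^ (1 / 2 : ℝ) ≤ ρ g)
    (heq : ∀ g, g 0 = 0 → ρ g = carlesonSup ω g ^ (1 / 2 : ℝ))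
    (h : ∃ M : ℝ≥0, ∀ A : ℝ≥0, ∃ g : ℂ → ℂ, Differentiable ℂ g ∧ g 0 = 0 ∧ carlesonSup ω g ≤ M ∧
      ∃ φ, IsDiscMobius φ ∧ A ≤ carlesonSup ω (g ∘ φ)) :
    ¬ IsConformallyInvariant (C1Space ω) ρ := by
  rintro ⟨C, -, hC⟩
  obtain ⟨M, hM⟩ := h
  -- Squaring the invariance inequality would bound the supremum for `g ∘ φ` by `C² M`; ask for one
  -- more.
  obtain ⟨g, hg, hg0, hgM, φ, hφ, hA⟩ := hM (C ^ 2 * M + 1)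
  have hmem : g ∈ C1Space ω := by
    refine ⟨hg.differentiableOn, ?_⟩
    rw [C1Norm, hg0]
    refine ENNReal.rpow_lt_top_of_nonneg (by norm_num) ?_
    simpa using (hgM.trans_lt ENNReal.coe_lt_top).ne
  have h1 : carlesonSup ω (g ∘ φ) ^ (1 / 2 : ℝ) ≤ C * carlesonSup ω g ^ (1 / 2 : ℝ) := by
    rw [← heq g hg0]
    exact (hle _).trans ((le_iSup₂_of_le φ hφ le_rfl).trans (hC g hmem))
  have h2 := ENNReal.rpow_le_rpow h1 (z := 2) (by norm_num)
  rw [ENNReal.mul_rpow_of_nonneg _ _ (by norm_num), ← ENNReal.rpow_mul, ← ENNReal.rpow_mul] at h2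
  norm_num at h2
  have h3 : ((C ^ 2 * M + 1 : ℝ≥0) : ℝ≥0∞) ≤ ((C ^ 2 * M : ℝ≥0) : ℝ≥0∞) := by
    refine hA.trans (h2.trans ?_)
    push_cast
    gcongr
  have h4 : C ^ 2 * M + 1 ≤ C ^ 2 * M := by exact_mod_cast h3
  exact absurd h4 (not_le.2 (lt_add_one _))

end BergmanWeights

theorem mainTheorem8 (ω : ℝ → ℝ)
    (hω : BergmanWeights.IsRapidlyIncreasing ω)
    (hinc : BergmanWeights.EssentiallyIncreasing ω)
    (hψ : BergmanWeights.EssentiallyIncreasing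
      (fun r => BergmanWeights.distortion ω r / (1 - r)))
    (hdoubling : ∃ C : ℝ, 0 < C ∧ ∀ r : ℝ, 0 ≤ r → r < 1 →
      (∫ s in r..1, ω s * s) ≤ C * ∫ s in (2 * r / (1 + r ^ 2))..1, ω s * s) :
    ¬ BergmanWeights.IsConformallyInvariant
        (BergmanWeights.C1Space ω) (BergmanWeights.C1Seminorm ω) ∧
    ¬ BergmanWeights.IsConformallyInvariant
        (BergmanWeights.C1Space ω) (BergmanWeights.C1Norm ω) := by
  have h := BergmanWeights.exists_carlesonSup_comp_unbounded hω.toIsRadialWeight hω.continuousOn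
    hinc hdoubling
  refine ⟨BergmanWeights.not_isConformallyInvariant_of_seminorm_le (fun _ => le_rfl)
    (fun _ _ => rfl) h, BergmanWeights.not_isConformallyInvariant_of_seminorm_le (fun g => ?_)
    (fun g hg => ?_) h⟩
  · exact ENNReal.rpow_le_rpow le_add_self (by norm_num)
  · simp [BergmanWeights.C1Norm, hg]
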